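/- Let $a,b,A,B\in\mathbb{C}\setminus\{0\}$ and consider the potential $$v(x)=a e^{-2ix}+b e^{2ix}+A e^{-4ix}+B e^{4ix},\qquad V(m)=\frac1\pi\int_0^\pi v(x)e^{-imx}\,dx\quad(m\in 2\mathbb{Z}).$$ An admissible walk from $-n$ to $n$ (respectively from $n$ to $-n$), $n\in\mathbb{N}$, is a finite sequence of steps $x=(x(t))_{t=1}^{\nu+1}$, $\nu=\nu(x)\ge 1$, $x(t)\in 2\mathbb{Z}$, with $\sum_{t=1}^{\nu+1}x(t)=2n$ (respectively $-2n$), whose vertices $j(t)=-n+\sum_{i\le t}x(i)$ (respectively $j(t)=n+\sum_{i\le t}x(i)$) satisfy $j(t)\ne\pm n$ for $1\le t\le\nu$. Let $X_n$ (respectively $Y_n$) be the set of these walks, and put $$h(x,z)=\frac{\prod_{t=1}^{\nu+1}V(x(t))}{\prod_{t=1}^{\nu}\left(n^2-j(t)^2+z\right)},\qquad B^+(n,z)=\sum_{x\in X_n}h(x,z),\qquad B^-(n,z)=\sum_{x\in Y_n}h(x,z).$$ Let $\alpha,\beta,\tau,\sigma\in\mathbb{C}$ (necessarily nonzero) satisfy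 $$A=-\alpha^2,\qquad a=-2\tau\alpha,\qquad B=-\beta^2,\qquad b=-2\sigma\beta .$$ If $\tau$ and $\sigma$ are not integers, then for all sufficiently large $n$ and all $z\in\mathbb{C}$ with $|z|\le 1$ the series defining $B^\pm(n,z)$ converge absolutely, and, as $n\to\infty$, uniformly in $|z|\le 1$, $$B^+(n,z)=\frac{4(i\beta/2)^n}{((n-2)!!)^2}\cos\Big(\frac{\pi\sigma}{2}\Big)\Big(1+O\Big(\frac{\log n}{n}\Big)\Big),\qquad B^-(n,z)=\frac{4(i\alpha/2)^n}{((n-2)!!)^2}\cos\Big(\frac{\pi\tau}{2}\Big)\Big(1+O\Big(\frac{\log n}{n}\Big)\Big)$$ for even $n$, and $$B^+(n,z)=\frac{4i(i\beta/2)^n}{((n-2)!!)^2}\,\frac{2}{\pi}\sin\Big(\frac{\pi\sigma}{2}\Big)\Big(1+O\Big(\frac{\log n}{n}\Big)\Big),\qquad B^-(n,z)=\frac{4i(i\alpha/2)^n}{((n-2)!!)^2}\,\frac{2}{\pi}\sin\Big(\frac{\pi\tau}{2}\Big)\Big(1+O\Big(\frac{\log n}{n}\Big)\Big)$$ for odd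 $n$. -/

import Mathlib

noncomputable section

/-- The potential `v(x) = a e^{-2ix} + b e^{2ix} + A e^{-4ix} + B e^{4ix}`. -/
def hillPotential (a b A B : ℂ) (x : ℝ) : ℂ :=
  a * Complex.exp (-2 * Complex.I * x) + b * Complex.exp (2 * Complex.I * x)
    + A * Complex.exp (-4 * Complex.I * x) + B * Complex.exp (4 * Complex.I * x)

/-- The Fourier coefficient `V(m)` (`m` an even integer) of a `π`-periodic function `v`
with respect to the system `e^{imx}`, `m ∈ 2ℤ`, on `[0, π]`. -/
def fourierCoeffPi (v : ℝ → ℂ) (m : ℤ) : ℂ :=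
  (1 / (Real.pi : ℂ)) * ∫ x in (0 : ℝ)..Real.pi, v x * Complex.exp (-(Complex.I * m * x))

/-- The vertex `j(t) = s + x(1) + ⋯ + x(t)` of the walk with start `s` and list of steps `x`. -/
def walkVertex (s : ℤ) (x : List ℤ) (t : ℕ) : ℤ :=
  s + (x.take t).sum

/-- The set of admissible walks from `s` to `-s`, given by their lists of steps
`x(1), …, x(ν + 1)`, `ν ≥ 1`: all steps are even, the walk ends at `-s`, and the intermediate
vertices `j(1), …, j(ν)` are different from `s` and `-s`. -/
def admissibleWalks (s : ℤ) : Set (List ℤ) :=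
  {x | 2 ≤ x.length ∧ (∀ m ∈ x, Even m) ∧ x.sum = -2 * s ∧
    ∀ t : ℕ, 1 ≤ t → t < x.length → walkVertex s x t ≠ s ∧ walkVertex s x t ≠ -s}

/-- The weight `h(x, z) = ∏_{t=1}^{ν+1} V(x(t)) / ∏_{t=1}^{ν} (n² - j(t)² + z)` of a walk `x`
with start `s`, where `s = ± n`, so that `n² = s²`. -/
def walkWeight (V : ℤ → ℂ) (s : ℤ) (x : List ℤ) (z : ℂ) : ℂ :=
  (x.map V).prod /
    ∏ t ∈ Finset.Ico 1 x.length, ((s : ℂ) ^ 2 - (walkVertex s x t : ℂ) ^ 2 + z)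

/-- `B⁺(n, z)`: the sum of `h(x, z)` over all admissible walks from `-n` to `n`. -/
def walkSumPlus (v : ℝ → ℂ) (n : ℕ) (z : ℂ) : ℂ :=
  ∑' x : admissibleWalks (-(n : ℤ)), walkWeight (fourierCoeffPi v) (-(n : ℤ)) x z

/-- `B⁻(n, z)`: the sum of `h(x, z)` over all admissible walks from `n` to `-n`. -/
def walkSumMinus (v : ℝ → ℂ) (n : ℕ) (z : ℂ) : ℂ :=
  ∑' x : admissibleWalks (n : ℤ), walkWeight (fourierCoeffPi v) (n : ℤ) x z

end

/-! In the coordinate `j = n - 2l` a walk from `-n` to `n` is a path from `l = n` to `l = 0`. A step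
`m` lowers `l` by `m / 2`, the denominators become `4l(n - l) + z`, and only the steps `±2`, `±4`
carry weight. The main term comes from the monotone paths (steps `2` and `4` only) with `z = 0`;
everything else is a relative error of order `log n / n`.

Main term. The monotone path sums are Taylor coefficients, below index `n`, of a solution of a
Whittaker type equation. Splitting off `e^{βx/2}` leaves a Kummer equation with a two-term
recurrence, so the total is an explicit product (`monoSum_last`). It equals the leading factor times
a partial Euler product of `cos (πσ/2)` or `(2/π) sin (πσ/2)`, depending on the parity of `n`
(`closed_form_eq_eulerProd`).

Error. Path by path, the full weight minus the monotone weight is bounded by the same difference for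
a majorant built from absolute values and from `1 / (|4l(n - l)| - 1)` (`norm_startWeight_sub_le`).
The majorant total is controlled by a supersolution of the first-step recurrence (`supersol_spec`):
between `0` and `n` it is the monotone sum times `1 + M ∑_{i ≤ l} 1 / (4i(n - i))`, and that sum is
at most `log n / n`.

The error is thus relative to the monotone sum of absolute values, not to the signed sum. The former
is the same product with `σ`, `β` replaced by `i|σ|`, `i|β|` (`absSum_total`), so it has the same
leading modulus times a bounded factor. The limit of the signed Euler products is nonzero because
`σ` is not an integer, so the error is also relative to the main term. Reflecting walks exchanges
`B⁺` and `B⁻`. -/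

/-! ### Path sums and the first-step recurrence -/

/-- The weight of the path that starts at the vertex `l` of `ℤ`, follows the steps of the list
(a step `m` moves by `-m / 2`) and has to end at `0`. -/
def pathWeight {R : Type*} [CommSemiring R] (c d : ℤ → R) : ℤ → List ℤ → R
  | l, [] => if l = 0 then 1 else 0
  | l, m :: x => d l * c m * pathWeight c d (l - m / 2) x

/-- The weight of a path that starts at `n`, where the weight of the vertex `n` is left out. -/
def startWeight {R : Type*} [CommSemiring R] (c d : ℤ → R) (n : ℤ) : List ℤ → R
  | [] => 0
  | m :: x => c m * pathWeight c d (n - m / 2) x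

/-- Step weights supported on `2`, `4`, `-2`, `-4`. -/
def stepWeight {R : Type*} [CommSemiring R] (b B a A : R) (m : ℤ) : R :=
  if m = 2 then b else if m = 4 then B else if m = -2 then a else if m = -4 then A else 0

/-- The lists of length at most `L` with entries in `{2, 4, -2, -4}`. -/
def stepLists : ℕ → Finset (List ℤ)
  | 0 => {[]}
  | L + 1 => insert []
      ((({2, 4, -2, -4} : Finset ℤ) ×ˢ stepLists L).image fun p => p.1 :: p.2)

theorem mem_stepLists {L : ℕ} {x : List ℤ} :
    x ∈ stepLists L ↔ (∀ m ∈ x, m ∈ ({2, 4, -2, -4} : Finset ℤ)) ∧ x.length ≤ L := by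
  induction L generalizing x with
  | zero =>
    cases x <;> simp [stepLists]
  | succ L ih =>
    cases x with
    | nil => simp [stepLists]
    | cons m x =>
      rw [stepLists, Finset.mem_insert, Finset.mem_image]
      simp only [reduceCtorEq, false_or, Finset.mem_product, Prod.exists, List.cons.injEq,
        List.forall_mem_cons, List.length_cons, Nat.add_le_add_iff_right]
      constructor
      · rintro ⟨m', x', ⟨h1, h2⟩, rfl, rfl⟩
        exact ⟨⟨h1, (ih.1 h2).1⟩, (ih.1 h2).2⟩
      · rintro ⟨⟨h1, h2⟩, h3⟩
        exact ⟨m, x, ⟨h1, ih.2 ⟨h2, h3⟩⟩, rfl, rfl⟩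

theorem sum_stepLists_succ {R : Type*} [AddCommMonoid R] (f : List ℤ → R) (L : ℕ) :
    ∑ x ∈ stepLists (L + 1), f x =
      f [] + ∑ m ∈ ({2, 4, -2, -4} : Finset ℤ), ∑ x ∈ stepLists L, f (m :: x) := by
  rw [stepLists, Finset.sum_insert (by simp), Finset.sum_image, Finset.sum_product]
  rintro ⟨m, x⟩ _ ⟨m', x'⟩ _ h
  simpa using h

theorem sum_steps {R : Type*} [AddCommMonoid R] (f : ℤ → R) :
    ∑ m ∈ ({2, 4, -2, -4} : Finset ℤ), f m = f 2 + (f 4 + (f (-2) + f (-4))) := by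
  rw [Finset.sum_insert (by decide), Finset.sum_insert (by decide), Finset.sum_insert (by decide),
    Finset.sum_singleton]

section Semiring

variable {R : Type*} [CommSemiring R] (b B a A : R) (d : ℤ → R)

@[simp] theorem stepWeight_two : stepWeight b B a A 2 = b := by simp [stepWeight]
@[simp] theorem stepWeight_four : stepWeight b B a A 4 = B := by simp [stepWeight]
@[simp] theorem stepWeight_neg_two : stepWeight b B a A (-2) = a := by simp [stepWeight]
@[simp] theorem stepWeight_neg_four : stepWeight b B a A (-4) = A := by simp [stepWeight]

theorem stepWeight_eq_zero {m : ℤ} (hm : m ∉ ({2, 4, -2, -4} : Finset ℤ)) :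
    stepWeight b B a A m = 0 := by
  simp only [Finset.mem_insert, Finset.mem_singleton, not_or] at hm
  simp [stepWeight, hm]

theorem sum_pathWeight_succ (L : ℕ) (l : ℤ) :
    ∑ x ∈ stepLists (L + 1), pathWeight (stepWeight b B a A) d l x =
      (if l = 0 then 1 else 0) + d l *
        (b * ∑ x ∈ stepLists L, pathWeight (stepWeight b B a A) d (l - 1) x
          + B * ∑ x ∈ stepLists L, pathWeight (stepWeight b B a A) d (l - 2) x
          + a * ∑ x ∈ stepLists L, pathWeight (stepWeight b B a A) d (l + 1) x
          + A * ∑ x ∈ stepLists L, pathWeight (stepWeight b B a A) d (l + 2) x) := by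
  rw [sum_stepLists_succ, sum_steps]
  simp only [pathWeight, ← Finset.mul_sum, stepWeight_two, stepWeight_four, stepWeight_neg_two,
    stepWeight_neg_four]
  norm_num
  ring

theorem sum_startWeight_succ (L : ℕ) (n : ℤ) :
    ∑ x ∈ stepLists (L + 1), startWeight (stepWeight b B a A) d n x =
        b * ∑ x ∈ stepLists L, pathWeight (stepWeight b B a A) d (n - 1) x
          + B * ∑ x ∈ stepLists L, pathWeight (stepWeight b B a A) d (n - 2) x
          + a * ∑ x ∈ stepLists L, pathWeight (stepWeight b B a A) d (n + 1) x
          + A * ∑ x ∈ stepLists L, pathWeight (stepWeight b B a A) d (n + 2) x := by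
  rw [sum_stepLists_succ, sum_steps]
  simp only [startWeight, ← Finset.mul_sum, stepWeight_two, stepWeight_four, stepWeight_neg_two,
    stepWeight_neg_four]
  norm_num
  ring

theorem mem_steps_of_pathWeight_ne_zero {l : ℤ} {x : List ℤ}
    (h : pathWeight (stepWeight b B a A) d l x ≠ 0) :
    ∀ m ∈ x, m ∈ ({2, 4, -2, -4} : Finset ℤ) := by
  induction x generalizing l with
  | nil => simp
  | cons m x ih =>
    rw [pathWeight] at h
    refine List.forall_mem_cons.2 ⟨?_, ih (right_ne_zero_of_mul h)⟩
    by_contra hm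
    exact h (by rw [stepWeight_eq_zero _ _ _ _ hm]; simp)

theorem startWeight_eq_zero_of_notMem {n : ℤ} {x : List ℤ} {L : ℕ} (hx : x.length ≤ L)
    (h : x ∉ stepLists L) : startWeight (stepWeight b B a A) d n x = 0 := by
  by_contra h0
  cases x with
  | nil => exact h0 rfl
  | cons m x =>
    rw [startWeight] at h0
    refine h (mem_stepLists.2 ⟨List.forall_mem_cons.2
      ⟨?_, mem_steps_of_pathWeight_ne_zero _ _ _ _ _ (right_ne_zero_of_mul h0)⟩, hx⟩)
    by_contra hm
    exact h0 (by rw [stepWeight_eq_zero _ _ _ _ hm]; simp)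

/-! ### Monotone paths -/

/-- The sum of the weights of the monotone paths from `l` to `0`. -/
def monoSum : ℕ → R
  | 0 => 1
  | 1 => d 1 * b
  | k + 2 => d ((k : ℤ) + 2) * (b * monoSum (k + 1) + B * monoSum k)

/-- Without backward steps, each step of nonzero weight lowers the vertex by at least one; so only
finitely many monotone paths count. -/
theorem length_le_of_mono {l : ℤ} {x : List ℤ}
    (h : pathWeight (stepWeight b B 0 0) d l x ≠ 0) : (x.length : ℤ) ≤ l := by
  induction x generalizing l with
  | nil =>
    have : l = 0 := by
      by_contra hl
      simp [pathWeight, hl] at h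
    simp [this]
  | cons m x ih =>
    have hx := h
    rw [pathWeight] at h
    have h1 := ih (right_ne_zero_of_mul h)
    have hc : stepWeight b B 0 0 m ≠ 0 := right_ne_zero_of_mul (left_ne_zero_of_mul h)
    have hm : 2 ≤ m := by
      by_contra hm
      refine hc ?_
      rw [stepWeight, if_neg (by omega), if_neg (by omega)]
      simp
    push_cast [List.length_cons]
    omega

theorem sum_mono_of_neg (L : ℕ) {l : ℤ} (hl : l < 0) :
    ∑ x ∈ stepLists L, pathWeight (stepWeight b B 0 0) d l x = 0 := by
  refine Finset.sum_eq_zero fun x _ => ?_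
  by_contra h
  have := length_le_of_mono b B d h
  omega

/-- The condition `d 0 = 0` removes the paths that pass through `0` and go on, and `k ≤ L` ensures
that the truncation loses no monotone path. -/
theorem sum_mono (hd : d 0 = 0) (L k : ℕ) (hk : k ≤ L) :
    ∑ x ∈ stepLists L, pathWeight (stepWeight b B 0 0) d k x = monoSum b B d k := by
  induction L generalizing k with
  | zero =>
    obtain rfl : k = 0 := by omega
    simp [stepLists, pathWeight, monoSum]
  | succ L ih =>
    rw [sum_pathWeight_succ]
    match k with
    | 0 => simp [hd, monoSum]
    | 1 =>
      have h0 := ih 0 (by omega)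
      have h1 := sum_mono_of_neg b B d L (l := -1) (by omega)
      simp only [Nat.cast_zero] at h0
      simp [h0, h1, monoSum]
    | k + 2 =>
      have h0 := ih k (by omega)
      have h1 := ih (k + 1) (by omega)
      have e1 : ((k + 2 : ℕ) : ℤ) - 1 = ((k + 1 : ℕ) : ℤ) := by push_cast; ring
      have e2 : ((k + 2 : ℕ) : ℤ) - 2 = (k : ℤ) := by push_cast; ring
      rw [e1, e2, h0, h1, if_neg (by omega), monoSum]
      push_cast
      ring

theorem startWeight_mono_support {n : ℕ} {x : List ℤ}
    (hx : x ∉ stepLists (n + 1)) : startWeight (stepWeight b B 0 0) d n x = 0 := by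
  by_cases hl : x.length ≤ n + 1
  · exact startWeight_eq_zero_of_notMem _ _ _ _ _ hl hx
  · by_contra h0
    cases x with
    | nil => exact h0 rfl
    | cons m x =>
      rw [startWeight] at h0
      have h1 := length_le_of_mono b B d (right_ne_zero_of_mul h0)
      have hm : 2 ≤ m := by
        by_contra hm
        refine left_ne_zero_of_mul h0 ?_
        rw [stepWeight, if_neg (by omega), if_neg (by omega)]
        simp
      simp only [List.length_cons] at hl
      omega

theorem sum_startWeight_mono (hd : d 0 = 0) (n : ℕ) :
    ∑ x ∈ stepLists (n + 2 + 1), startWeight (stepWeight b B 0 0) d ((n + 2 : ℕ) : ℤ) x =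
      b * monoSum b B d (n + 1) + B * monoSum b B d n := by
  have e1 : ((n + 2 : ℕ) : ℤ) - 1 = ((n + 1 : ℕ) : ℤ) := by push_cast; ring
  have e2 : ((n + 2 : ℕ) : ℤ) - 2 = (n : ℤ) := by push_cast; ring
  rw [sum_startWeight_succ, e1, e2, sum_mono b B d hd _ _ (by omega),
    sum_mono b B d hd _ _ (by omega)]
  ring

end Semiring

/-! ### Termwise comparison with a majorant -/

/-- The pair of relations `‖x - y‖ ≤ X - Y`, `‖y‖ ≤ Y` is stable under products, so it propagates
from single step and vertex weights to whole paths by induction. -/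
theorem norm_mul_sub_mul_le {x x' y y' : ℂ} {X X' Y Y' : ℝ} (h : ‖x - y‖ ≤ X - Y)
    (h' : ‖x' - y'‖ ≤ X' - Y') (hy : ‖y‖ ≤ Y) (hy' : ‖y'‖ ≤ Y') :
    ‖x * x' - y * y'‖ ≤ X * X' - Y * Y' := by
  have e : x * x' - y * y' = (x - y) * x' + y * (x' - y') := by ring
  have hx' : ‖x'‖ ≤ X' := by
    calc ‖x'‖ = ‖(x' - y') + y'‖ := by rw [sub_add_cancel]
      _ ≤ ‖x' - y'‖ + ‖y'‖ := norm_add_le _ _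
      _ ≤ X' := by linarith
  calc ‖x * x' - y * y'‖ ≤ ‖x - y‖ * ‖x'‖ + ‖y‖ * ‖x' - y'‖ := by
        rw [e, ← norm_mul, ← norm_mul]; exact norm_add_le _ _
    _ ≤ (X - Y) * X' + Y * (X' - Y') :=
        add_le_add (mul_le_mul h hx' (norm_nonneg _) ((norm_nonneg _).trans h))
          (mul_le_mul hy h' (norm_nonneg _) ((norm_nonneg _).trans hy))
    _ = X * X' - Y * Y' := by ring

theorem norm_mul_le_mul {y y' : ℂ} {Y Y' : ℝ} (hy : ‖y‖ ≤ Y) (hy' : ‖y'‖ ≤ Y') :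
    ‖y * y'‖ ≤ Y * Y' := by
  rw [norm_mul]
  exact mul_le_mul hy hy' (norm_nonneg _) ((norm_nonneg _).trans hy)

section Compare

variable {c c0 d d0 : ℤ → ℂ} {C C0 D D0 : ℤ → ℝ}

theorem norm_pathWeight_le (hc0 : ∀ m, ‖c0 m‖ ≤ C0 m) (hd0 : ∀ l, ‖d0 l‖ ≤ D0 l) (l : ℤ)
    (x : List ℤ) : ‖pathWeight c0 d0 l x‖ ≤ pathWeight C0 D0 l x := by
  induction x generalizing l with
  | nil => simp only [pathWeight]; split_ifs <;> simp
  | cons m x ih => exact norm_mul_le_mul (norm_mul_le_mul (hd0 l) (hc0 m)) (ih _)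

theorem norm_pathWeight_sub_le (hc0 : ∀ m, ‖c0 m‖ ≤ C0 m) (hd0 : ∀ l, ‖d0 l‖ ≤ D0 l)
    (hc : ∀ m, ‖c m - c0 m‖ ≤ C m - C0 m) (hd : ∀ l, ‖d l - d0 l‖ ≤ D l - D0 l) (l : ℤ)
    (x : List ℤ) :
    ‖pathWeight c d l x - pathWeight c0 d0 l x‖ ≤ pathWeight C D l x - pathWeight C0 D0 l x := by
  induction x generalizing l with
  | nil => simp only [pathWeight]; split_ifs <;> simp
  | cons m x ih =>
    exact norm_mul_sub_mul_le (norm_mul_sub_mul_le (hd l) (hc m) (hd0 l) (hc0 m)) (ih _)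
      (norm_mul_le_mul (hd0 l) (hc0 m)) (norm_pathWeight_le hc0 hd0 _ _)

theorem norm_startWeight_le (hc0 : ∀ m, ‖c0 m‖ ≤ C0 m) (hd0 : ∀ l, ‖d0 l‖ ≤ D0 l) (n : ℤ)
    (x : List ℤ) : ‖startWeight c0 d0 n x‖ ≤ startWeight C0 D0 n x := by
  cases x with
  | nil => simp [startWeight]
  | cons m x => exact norm_mul_le_mul (hc0 m) (norm_pathWeight_le hc0 hd0 _ _)

theorem norm_startWeight_sub_le (hc0 : ∀ m, ‖c0 m‖ ≤ C0 m) (hd0 : ∀ l, ‖d0 l‖ ≤ D0 l)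
    (hc : ∀ m, ‖c m - c0 m‖ ≤ C m - C0 m) (hd : ∀ l, ‖d l - d0 l‖ ≤ D l - D0 l) (n : ℤ)
    (x : List ℤ) :
    ‖startWeight c d n x - startWeight c0 d0 n x‖
      ≤ startWeight C D n x - startWeight C0 D0 n x := by
  cases x with
  | nil => simp [startWeight]
  | cons m x =>
    exact norm_mul_sub_mul_le (hc m) (norm_pathWeight_sub_le hc0 hd0 hc hd _ _) (hc0 m)
      (norm_pathWeight_le hc0 hd0 _ _)

end Compare

/-! ### Supersolutions bound path sums -/

section Supersolution

variable {b B a A : ℝ} {D Φ : ℤ → ℝ}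

/-- The truncated sums are iterates of a recurrence with nonnegative coefficients, and such iterates
stay below a nonnegative supersolution. The bound does not depend on `L`, which later yields
summability. -/
theorem sum_pathWeight_le (hb : 0 ≤ b) (hB : 0 ≤ B) (ha : 0 ≤ a) (hA : 0 ≤ A)
    (hD : ∀ l, 0 ≤ D l) (hΦ : ∀ l, (if l = 0 then 1 else 0) +
      D l * (b * Φ (l - 1) + B * Φ (l - 2) + a * Φ (l + 1) + A * Φ (l + 2)) ≤ Φ l)
    (hΦ0 : ∀ l, 0 ≤ Φ l) (L : ℕ) (l : ℤ) :
    ∑ x ∈ stepLists L, pathWeight (stepWeight b B a A) D l x ≤ Φ l := by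
  induction L generalizing l with
  | zero =>
    refine le_trans ?_ (hΦ l)
    rw [stepLists, Finset.sum_singleton, pathWeight]
    have h1 := hD l
    have h2 := hΦ0 (l - 1)
    have h3 := hΦ0 (l - 2)
    have h4 := hΦ0 (l + 1)
    have h5 := hΦ0 (l + 2)
    exact le_add_of_nonneg_right (by positivity)
  | succ L ih =>
    refine le_trans ?_ (hΦ l)
    rw [sum_pathWeight_succ]
    have h1 := hD l
    gcongr <;> exact ih _

theorem sum_startWeight_le (hb : 0 ≤ b) (hB : 0 ≤ B) (ha : 0 ≤ a) (hA : 0 ≤ A)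
    (hD : ∀ l, 0 ≤ D l) (hΦ : ∀ l, (if l = 0 then 1 else 0) +
      D l * (b * Φ (l - 1) + B * Φ (l - 2) + a * Φ (l + 1) + A * Φ (l + 2)) ≤ Φ l)
    (hΦ0 : ∀ l, 0 ≤ Φ l) (n : ℤ) (hst : ∀ x, 0 ≤ startWeight (stepWeight b B a A) D n x)
    (t : Finset (List ℤ)) :
    ∑ x ∈ t, startWeight (stepWeight b B a A) D n x
      ≤ b * Φ (n - 1) + B * Φ (n - 2) + a * Φ (n + 1) + A * Φ (n + 2) := by
  set L := t.sup List.length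
  have h1 : ∑ x ∈ t, startWeight (stepWeight b B a A) D n x
      ≤ ∑ x ∈ stepLists (L + 1), startWeight (stepWeight b B a A) D n x := by
    -- A list of `t` outside `stepLists (L + 1)` is short enough, so it must contain a step of
    -- weight zero.
    rw [← Finset.sum_subset (Finset.inter_subset_left (s₂ := stepLists (L + 1)))]
    · exact Finset.sum_le_sum_of_subset_of_nonneg Finset.inter_subset_right fun x _ _ => hst x
    · intro x hx h
      exact startWeight_eq_zero_of_notMem _ _ _ _ _
        ((Finset.le_sup (f := List.length) hx).trans (Nat.le_succ _))
        fun h' => h (Finset.mem_inter.2 ⟨hx, h'⟩)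
  refine h1.trans ?_
  rw [sum_startWeight_succ]
  have key := sum_pathWeight_le hb hB ha hA hD hΦ hΦ0 L
  gcongr <;> exact key _

end Supersolution

/-! ### The majorant and its supersolution -/

section Majorant

variable (b B a A : ℝ) (n : ℕ)

/-- The vertex weights of the monotone paths. -/
noncomputable def monoVertex (l : ℤ) : ℝ :=
  if 0 < l ∧ l < n then (4 * (l : ℝ) * (n - l))⁻¹ else 0

/-- A bound for the vertex weights that is uniform in `|z| ≤ 1`. -/
noncomputable def majorVertex (l : ℤ) : ℝ :=
  if l = 0 ∨ l = n then 0 else (|4 * (l : ℝ) * (n - l)| - 1)⁻¹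

/-- The monotone path sums with the absolute values of the weights. -/
noncomputable def absSum (k : ℕ) : ℝ := monoSum b B (monoVertex n) k

/-- `∑_{i ≤ k} 1 / (4 i (n - i))`. -/
noncomputable def greenSum (k : ℕ) : ℝ :=
  ∑ i ∈ Finset.range k, (4 * ((i : ℝ) + 1) * (n - (i + 1)))⁻¹

/-- A supersolution of the recurrence for the path sums. -/
noncomputable def supersol (M : ℝ) (l : ℤ) : ℝ :=
  if l < 0 then (b + B + a + A) / n
  else if l < n then (1 + M * greenSum n l.toNat) * absSum b B n l.toNat
  else if l = n then 0
  else 2 * (b + B + a + A) * absSum b B n (n - 1) / n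

variable {b B a A n}

theorem absSum_zero : absSum b B n 0 = 1 := rfl

theorem absSum_one (hn : 2 ≤ n) : 4 * ((n : ℝ) - 1) * absSum b B n 1 = b := by
  have h : (2 : ℝ) ≤ n := by exact_mod_cast hn
  have h1 : 4 * ((n : ℝ) - 1) ≠ 0 := by nlinarith
  rw [absSum, monoSum, monoVertex, if_pos ⟨by norm_num, by exact_mod_cast hn⟩]
  push_cast
  rw [mul_one, mul_inv_cancel_left₀ h1]

theorem vertex_pos {k : ℕ} (hk : 0 < k) (hkn : k < n) : 0 < 4 * (k : ℝ) * (n - k) := by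
  have h1 : (0 : ℝ) < k := by exact_mod_cast hk
  have h2 : (k : ℝ) < n := by exact_mod_cast hkn
  have : (0 : ℝ) < n - k := by linarith
  positivity

theorem absSum_add_two {k : ℕ} (hk : k + 2 < n) :
    4 * ((k : ℝ) + 2) * (n - (k + 2)) * absSum b B n (k + 2)
      = b * absSum b B n (k + 1) + B * absSum b B n k := by
  have h := vertex_pos (k := k + 2) (by omega) hk
  push_cast at h
  rw [absSum, monoSum, monoVertex, if_pos ⟨by omega, by exact_mod_cast hk⟩]
  push_cast
  rw [mul_inv_cancel_left₀ h.ne']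
  rfl

theorem absSum_pos (hb : 0 < b) (hB : 0 ≤ B) {k : ℕ} (hk : k < n) : 0 < absSum b B n k := by
  induction k using Nat.strong_induction_on with
  | _ k ih =>
    match k with
    | 0 => exact zero_lt_one
    | 1 =>
      have h := absSum_one (b := b) (B := B) (n := n) (by omega)
      have h' := vertex_pos (k := 1) one_pos hk
      push_cast at h'
      refine pos_of_mul_pos_right (a := 4 * ((n : ℝ) - 1)) ?_ (by linarith)
      rw [h]; exact hb
    | k + 2 =>
      have h := absSum_add_two (b := b) (B := B) hk
      have h' := vertex_pos (k := k + 2) (by omega) hk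
      push_cast at h'
      refine pos_of_mul_pos_right (a := 4 * ((k : ℝ) + 2) * (n - (k + 2))) ?_ h'.le
      rw [h]
      have h1 := ih (k + 1) (by omega) (by omega)
      have h2 := ih k (by omega) (by omega)
      positivity

theorem mul_absSum_le (hb : 0 < b) (hB : 0 ≤ B) {k : ℕ} (hk : k + 1 < n) :
    b * absSum b B n k ≤ 4 * ((k : ℝ) + 1) * (n - (k + 1)) * absSum b B n (k + 1) := by
  cases k with
  | zero =>
    rw [absSum_zero]
    have h := absSum_one (b := b) (B := B) (n := n) (by omega)
    push_cast
    linarith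
  | succ k =>
    have h := absSum_add_two (b := b) (B := B) hk
    have h2 := absSum_pos hb hB (k := k) (n := n) (by omega)
    have := mul_nonneg hB h2.le
    push_cast at h ⊢
    rw [show (k : ℝ) + 1 + 1 = k + 2 by ring, show k + 1 + 1 = k + 2 by ring]
    linarith

/-- In the two-term recurrence the older value is at most a constant times the newer one, by
`mul_absSum_le`; hence the growth per index is bounded uniformly in `n`. -/
theorem absSum_succ_le (hb : 0 < b) (hB : 0 ≤ B) {k : ℕ} (hk : 1 ≤ k) (hkn : k + 1 < n) :
    absSum b B n (k + 1) ≤ (1 + b + 2 * B / b) * absSum b B n k := by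
  obtain ⟨k, rfl⟩ := Nat.exists_eq_add_of_le' hk
  have h1 := absSum_add_two (b := b) (B := B) hkn
  have h2 := mul_absSum_le hb hB (k := k) (n := n) (by omega)
  have hu := absSum_pos hb hB (k := k + 1) (n := n) (by omega)
  set u := absSum b B n (k + 1)
  set D : ℝ := 4 * ((k : ℝ) + 2) * (n - (k + 2)) with hD
  have hn' : (k : ℝ) + 3 ≤ n := by exact_mod_cast hkn
  have hk0 : (0 : ℝ) ≤ k := Nat.cast_nonneg k
  have hD1 : 1 ≤ D := by rw [hD]; nlinarith
  -- Neighbouring denominators differ at most by the factor `2`, since `n - (k + 1) ≤ 2 (n - (k +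
  -- 2))` when `k + 3 ≤ n`.
  have hDD : 4 * ((k : ℝ) + 1) * (n - (k + 1)) ≤ 2 * D := by rw [hD]; nlinarith
  have h3 : absSum b B n k ≤ 2 * D * u / b := by
    rw [le_div_iff₀ hb]
    nlinarith
  have h4 : B * absSum b B n k ≤ 2 * B / b * (D * u) := by
    calc B * absSum b B n k ≤ B * (2 * D * u / b) := mul_le_mul_of_nonneg_left h3 hB
      _ = 2 * B / b * (D * u) := by ring
  have h5 : b * u ≤ b * (D * u) := by
    refine mul_le_mul_of_nonneg_left ?_ hb.le
    nlinarith
  have h6 : D * absSum b B n (k + 1 + 1) ≤ D * ((1 + b + 2 * B / b) * u) := by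
    have : 0 < D * u := by positivity
    calc D * absSum b B n (k + 1 + 1) = b * u + B * absSum b B n k := h1
      _ ≤ b * (D * u) + 2 * B / b * (D * u) := add_le_add h5 h4
      _ ≤ D * ((1 + b + 2 * B / b) * u) := by nlinarith
  exact le_of_mul_le_mul_left h6 (by linarith)

theorem greenSum_succ (k : ℕ) :
    greenSum n (k + 1) = greenSum n k + (4 * ((k : ℝ) + 1) * (n - (k + 1)))⁻¹ := by
  rw [greenSum, Finset.sum_range_succ]; rfl

theorem greenSum_nonneg {k : ℕ} (hk : k < n) : 0 ≤ greenSum n k := by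
  refine Finset.sum_nonneg fun i hi => ?_
  have hi := Finset.mem_range.1 hi
  have := vertex_pos (k := i + 1) (n := n) (by omega) (by omega)
  push_cast at this
  exact (inv_pos.2 this).le

theorem greenSum_le_last {k : ℕ} (hk : k < n) : greenSum n k ≤ greenSum n (n - 1) := by
  refine Finset.sum_le_sum_of_subset_of_nonneg (Finset.range_mono (by omega)) fun i hi _ => ?_
  have hi := Finset.mem_range.1 hi
  have := vertex_pos (k := i + 1) (n := n) (by omega) (by omega)
  push_cast at this
  exact (inv_pos.2 this).le

/-- By partial fractions the sum is `H_{n-1} / (2n)` with `H` the harmonic number, and `H_{n-1} ≤ 1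
+ log n ≤ 2 log n` as `n ≥ 3 > e`. -/
theorem greenSum_le_log (hn : 3 ≤ n) : greenSum n (n - 1) ≤ Real.log n / n := by
  obtain ⟨m, rfl⟩ := Nat.exists_eq_add_of_le' hn
  set n := m + 3
  have hn0 : (0 : ℝ) < n := by positivity
  have h1 : greenSum n (n - 1) = ∑ i ∈ Finset.range (n - 1),
      (1 / (4 * (n : ℝ))) * (((i : ℝ) + 1)⁻¹ + ((n : ℝ) - (i + 1))⁻¹) := by
    refine Finset.sum_congr rfl fun i hi => ?_
    have hi := Finset.mem_range.1 hi
    have h2 : ((i : ℝ) + 1) < n := by exact_mod_cast (by omega : i + 1 < n)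
    have h3 : (n : ℝ) - (i + 1) ≠ 0 := by linarith
    have h4 : (i : ℝ) + 1 ≠ 0 := by positivity
    field_simp
    ring
  have hH : ∑ i ∈ Finset.range (n - 1), ((i : ℝ) + 1)⁻¹ = (harmonic (n - 1) : ℝ) := by
    rw [harmonic]; push_cast; rfl
  have hH' : ∑ i ∈ Finset.range (n - 1), ((n : ℝ) - (i + 1))⁻¹ = (harmonic (n - 1) : ℝ) := by
    rw [← hH, ← Finset.sum_range_reflect]
    refine Finset.sum_congr rfl fun i hi => ?_
    have hi := Finset.mem_range.1 hi
    rw [Nat.sub_sub, Nat.cast_sub (by omega), Nat.cast_sub (by omega)]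
    push_cast
    congr 1
    ring
  have hlog : (1 : ℝ) ≤ Real.log n := by
    rw [Real.le_log_iff_exp_le hn0]
    refine Real.exp_one_lt_three.le.trans ?_
    exact_mod_cast (by omega : 3 ≤ n)
  have hle : (harmonic (n - 1) : ℝ) ≤ 1 + Real.log n := by
    refine (harmonic_le_one_add_log _).trans (add_le_add_right (Real.log_le_log ?_ ?_) _)
    · exact_mod_cast (by omega : 0 < n - 1)
    · exact_mod_cast (by omega : n - 1 ≤ n)
  rw [h1, ← Finset.mul_sum, Finset.sum_add_distrib, hH, hH', le_div_iff₀ hn0]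
  have : 1 / (4 * (n : ℝ)) * ((harmonic (n - 1) : ℝ) + harmonic (n - 1)) * n
      = (harmonic (n - 1) : ℝ) / 2 := by
    field_simp; ring
  rw [this]
  linarith

variable {M : ℝ}

theorem supersol_neg {l : ℤ} (hl : l < 0) : supersol b B a A n M l = (b + B + a + A) / n :=
  if_pos hl

theorem supersol_nat {k : ℕ} (hk : k < n) :
    supersol b B a A n M k = (1 + M * greenSum n k) * absSum b B n k := by
  rw [supersol, if_neg (by omega), if_pos (by exact_mod_cast hk), Int.toNat_natCast]

theorem supersol_self : supersol b B a A n M n = 0 := by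
  rw [supersol, if_neg (by omega), if_neg (lt_irrefl _), if_pos rfl]

theorem supersol_gt {l : ℤ} (hl : (n : ℤ) < l) :
    supersol b B a A n M l = 2 * (b + B + a + A) * absSum b B n (n - 1) / n := by
  rw [supersol, if_neg (by omega), if_neg (by omega), if_neg (by omega)]

end Majorant

/-! ### Verification of the supersolution inequality -/

section MajorantBound

variable {b B a A : ℝ} {n : ℕ} {M : ℝ}

theorem majorVertex_mul_le {l : ℤ} {r s : ℝ} (h1 : 1 < |4 * (l : ℝ) * (n - l)|)
    (h : r ≤ s * (|4 * (l : ℝ) * (n - l)| - 1)) (h0 : l ≠ 0) (hn : l ≠ n) :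
    (if l = 0 then 1 else 0) + majorVertex n l * r ≤ s := by
  rw [if_neg h0, majorVertex, if_neg (not_or.2 ⟨h0, hn⟩), zero_add, inv_mul_le_iff₀ (by linarith)]
  linarith

theorem lt_abs_vertex {l : ℤ} (h : l < 0 ∨ (n : ℤ) < l) :
    4 * ((n : ℝ) + 1) ≤ |4 * (l : ℝ) * (n - l)| := by
  have hn0 : (0 : ℝ) ≤ n := Nat.cast_nonneg n
  rw [le_abs]
  right
  rcases h with h | h
  · have : (l : ℝ) ≤ -1 := by exact_mod_cast (by omega : l ≤ -1)
    nlinarith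
  · have : (n : ℝ) + 1 ≤ l := by exact_mod_cast (by omega : (n : ℤ) + 1 ≤ l)
    nlinarith

theorem majorVertex_nonneg (hn : 2 ≤ n) (l : ℤ) : 0 ≤ majorVertex n l := by
  rw [majorVertex]
  split_ifs with h
  · exact le_rfl
  · rw [not_or] at h
    refine inv_nonneg.2 (sub_nonneg.2 ?_)
    have hn' : (2 : ℝ) ≤ n := by exact_mod_cast hn
    rcases lt_or_gt_of_ne h.1 with h0 | h0
    · have := lt_abs_vertex (n := n) (Or.inl h0)
      linarith
    · rcases lt_or_gt_of_ne h.2 with h1 | h1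
      · have h2 : (1 : ℝ) ≤ l := by exact_mod_cast h0
        have h3 : (l : ℝ) + 1 ≤ n := by exact_mod_cast h1
        refine le_trans ?_ (le_abs_self _)
        nlinarith
      · have := lt_abs_vertex (n := n) (Or.inr h1)
        linarith

variable (hb : 0 < b) (hB : 0 ≤ B) (ha : 0 ≤ a) (hA : 0 ≤ A) (hn : 3 ≤ n)
  (hS : b + B + a + A ≤ n) (hM0 : 0 ≤ M) (hMG : M * greenSum n (n - 1) ≤ 1)

include hM0 hMG in
theorem amplification_bounds {k : ℕ} (hk : k < n) :
    0 ≤ M * greenSum n k ∧ M * greenSum n k ≤ 1 :=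
  ⟨mul_nonneg hM0 (greenSum_nonneg hk),
    (mul_le_mul_of_nonneg_left (greenSum_le_last hk) hM0).trans hMG⟩

include hb hB hM0 hMG in
theorem supersol_nat_le {k : ℕ} (hk : k < n) :
    supersol b B a A n M k ≤ 2 * absSum b B n k := by
  rw [supersol_nat hk]
  have h := amplification_bounds hM0 hMG hk
  have h' := absSum_pos hb hB hk
  nlinarith

include hb hB ha hA hn hM0 hMG in
theorem supersol_nonneg (l : ℤ) : 0 ≤ supersol b B a A n M l := by
  rcases lt_or_ge l 0 with h | h
  · rw [supersol_neg h]; positivity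
  · obtain ⟨k, rfl⟩ := Int.eq_ofNat_of_zero_le h
    rcases lt_trichotomy k n with h1 | rfl | h1
    · rw [supersol_nat h1]
      have h := amplification_bounds hM0 hMG h1
      have h' := absSum_pos hb hB h1
      have : 0 ≤ 1 + M * greenSum n k := by linarith
      positivity
    · rw [supersol_self]
    · rw [supersol_gt (by exact_mod_cast h1)]
      have h' := absSum_pos hb hB (k := n - 1) (n := n) (by omega)
      positivity

include hb hB hn hS hM0 hMG ha hA in
theorem supersol_le_one {l : ℤ} (hl : l ≤ 1) : supersol b B a A n M l ≤ 1 := by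
  have hn' : (3 : ℝ) ≤ n := by exact_mod_cast hn
  rcases lt_or_ge l 0 with h | h
  · rw [supersol_neg h, div_le_one (by linarith)]
    exact hS
  · obtain rfl | rfl : l = 0 ∨ l = 1 := by omega
    · have := supersol_nat (b := b) (B := B) (a := a) (A := A) (M := M) (n := n) (k := 0) (by omega)
      rw [Nat.cast_zero] at this
      rw [this, absSum_zero, greenSum]
      simp
    · have h1 := supersol_nat_le (a := a) (A := A) hb hB hM0 hMG (k := 1) (by omega)
      have h2 := absSum_one (b := b) (B := B) (n := n) (by omega)
      rw [Nat.cast_one] at h1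
      refine h1.trans ?_
      have h3 : b ≤ n := by linarith
      have h4 := absSum_pos hb hB (k := 1) (n := n) (by omega)
      nlinarith

include hb hB hn hS hM0 hMG in
theorem supersol_le_of_ge {l : ℤ} (hl : (n : ℤ) - 1 ≤ l) :
    supersol b B a A n M l ≤ 2 * absSum b B n (n - 1) := by
  have hn' : (3 : ℝ) ≤ n := by exact_mod_cast hn
  have h4 := absSum_pos hb hB (k := n - 1) (n := n) (by omega)
  rcases lt_or_ge (n : ℤ) l with h | h
  · rw [supersol_gt h, div_le_iff₀ (by linarith)]
    nlinarith
  · obtain rfl | rfl : l = ((n - 1 : ℕ) : ℤ) ∨ l = n := by omega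
    · exact supersol_nat_le hb hB hM0 hMG (by omega)
    · rw [supersol_self]; positivity

include hb hB hn hS hM0 hMG in
-- This prices the backward steps `-2` and `-4`: by `absSum_succ_le` they cost only a bounded
-- factor, also when they lead to or beyond `n`.
theorem supersol_next_le {k : ℕ} (hk : 1 ≤ k) (hkn : k < n) :
    supersol b B a A n M (k + 1) ≤ 2 * (1 + b + 2 * B / b) * absSum b B n k ∧
    supersol b B a A n M (k + 2) ≤ 2 * (1 + b + 2 * B / b) ^ 2 * absSum b B n k := by
  set C := 1 + b + 2 * B / b with hC
  have hC1 : 1 ≤ C := by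
    have : 0 ≤ 2 * B / b := by positivity
    linarith
  have hu := absSum_pos hb hB hkn
  have hsucc : ∀ j : ℕ, 1 ≤ j → j < n →
      supersol b B a A n M ((j : ℤ) + 1) ≤ 2 * C * absSum b B n j := by
    intro j hj hjn
    have huj := absSum_pos hb hB hjn
    rcases (Nat.succ_le_of_lt hjn).lt_or_eq with h | h
    · have h1 := supersol_nat_le (a := a) (A := A) hb hB hM0 hMG h
      have h2 := absSum_succ_le hb hB hj h
      push_cast at h1
      linarith
    · rw [show (j : ℤ) + 1 = n by omega, supersol_self]
      positivity
  refine ⟨hsucc k hk hkn, ?_⟩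
  rcases (Nat.succ_le_of_lt hkn).lt_or_eq with h | h
  · have h1 := hsucc (k + 1) (by omega) h
    have h2 := absSum_succ_le hb hB hk h
    push_cast at h1
    rw [add_assoc] at h1
    norm_num at h1
    refine h1.trans ?_
    calc 2 * C * absSum b B n (k + 1) ≤ 2 * C * (C * absSum b B n k) := by gcongr
      _ = 2 * C ^ 2 * absSum b B n k := by ring
  · obtain rfl : k = n - 1 := by omega
    refine (supersol_le_of_ge hb hB hn hS hM0 hMG (by omega)).trans ?_
    have : 1 ≤ C ^ 2 := one_le_pow₀ hC1
    nlinarith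

include hb hB ha hA hn hM0 in
-- The increment of `greenSum` at `k` is the reciprocal of `4k(n - k)`, so the forward steps leave a
-- surplus of `M * absSum b B n k`. The last term pays for `k = 1`, where the step `4` overshoots to
-- `l = -1`.
theorem supersol_prev_le {k : ℕ} (hk : 1 ≤ k) (hkn : k < n) :
    b * supersol b B a A n M (k - 1) + B * supersol b B a A n M (k - 2)
      ≤ (1 + M * greenSum n k) * (4 * (k : ℝ) * (n - k)) * absSum b B n k
        - M * absSum b B n k + 4 * B * (b + B + a + A) / b * absSum b B n k := by
  have hn' : (3 : ℝ) ≤ n := by exact_mod_cast hn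
  obtain ⟨k, rfl⟩ := Nat.exists_eq_add_of_le' hk
  have hv := vertex_pos hk hkn
  have hu := absSum_pos hb hB hkn
  have e : (1 + M * greenSum n (k + 1)) * (4 * ((k + 1 : ℕ) : ℝ) * (n - (k + 1 : ℕ)))
      * absSum b B n (k + 1) - M * absSum b B n (k + 1)
      = (1 + M * greenSum n k) * (4 * ((k + 1 : ℕ) : ℝ) * (n - (k + 1 : ℕ)))
        * absSum b B n (k + 1) := by
    rw [greenSum_succ]
    push_cast at hv ⊢
    linear_combination M * absSum b B n (k + 1) * mul_inv_cancel₀ hv.ne'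
  rw [e]
  have hC : 0 ≤ 4 * B * (b + B + a + A) / b * absSum b B n (k + 1) := by positivity
  cases k with
  | zero =>
    have h0 := supersol_nat (b := b) (B := B) (a := a) (A := A) (M := M) (n := n) (k := 0) (by omega)
    have h1 := absSum_one (b := b) (B := B) (n := n) (by omega)
    rw [Nat.cast_zero, absSum_zero, mul_one, greenSum, Finset.sum_range_zero, mul_zero,
      add_zero] at h0
    have e1 : ((0 + 1 : ℕ) : ℤ) - 1 = 0 := by norm_num
    rw [e1, h0, supersol_neg (by norm_num), greenSum, Finset.sum_range_zero]
    have h2 : 4 * B * (b + B + a + A) / b * absSum b B n (0 + 1)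
        = B * ((b + B + a + A) / ((n : ℝ) - 1)) := by
      have h3 : absSum b B n (0 + 1) = b / (4 * ((n : ℝ) - 1)) := by
        rw [zero_add, eq_div_iff (by nlinarith)]; linear_combination h1
      have h5 : (n : ℝ) - 1 ≠ 0 := by linarith
      rw [h3]
      field_simp
    have h4 : B * ((b + B + a + A) / (n : ℝ)) ≤ B * ((b + B + a + A) / ((n : ℝ) - 1)) := by
      refine mul_le_mul_of_nonneg_left ?_ hB
      exact div_le_div_of_nonneg_left (by positivity) (by linarith) (by linarith)
    rw [h2]
    push_cast
    norm_num at h1 ⊢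
    linarith
  | succ k =>
    have h1 := absSum_add_two (b := b) (B := B) hkn
    have h2 := supersol_nat (b := b) (B := B) (a := a) (A := A) (M := M) (n := n) (k := k + 1)
      (by omega)
    have h3 := supersol_nat (b := b) (B := B) (a := a) (A := A) (M := M) (n := n) (k := k)
      (by omega)
    have e1 : ((k + 1 + 1 : ℕ) : ℤ) - 1 = ((k + 1 : ℕ) : ℤ) := by push_cast; ring
    have e2 : ((k + 1 + 1 : ℕ) : ℤ) - 2 = ((k : ℕ) : ℤ) := by push_cast; ring
    rw [e1, e2, h2, h3]
    have hg : greenSum n k ≤ greenSum n (k + 1) := by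
      rw [greenSum_succ]
      have := vertex_pos (k := k + 1) (n := n) (by omega) (by omega)
      push_cast at this
      have := inv_pos.2 this
      linarith
    have hu' := absSum_pos hb hB (k := k) (n := n) (by omega)
    have h4 : B * ((1 + M * greenSum n k) * absSum b B n k)
        ≤ B * ((1 + M * greenSum n (k + 1)) * absSum b B n k) := by gcongr
    have h5 : (1 + M * greenSum n (k + 1)) * (4 * ((k + 1 + 1 : ℕ) : ℝ) * (n - (k + 1 + 1 : ℕ)))
        * absSum b B n (k + 1 + 1)
        = (1 + M * greenSum n (k + 1)) * (b * absSum b B n (k + 1) + B * absSum b B n k) := by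
      rw [← h1]; push_cast; ring
    rw [h5]
    nlinarith

include hb hB ha hA hn hS hM0 hMG in
-- For `0 < l < n` the surplus from `supersol_prev_le` covers three costs, matching the summands of
-- `M`: the `-1` in the denominator of `majorVertex` (amplification at most `2`), the backward
-- steps, and the overshoot to `l = -1`. Outside `[0, n]` the denominators are at least `4n + 3`, so
-- constants of order `1 / n` suffice; at `0` and `n` the vertex weight vanishes.
theorem supersol_spec
    (hM : M = 2 + 2 * (a * (1 + b + 2 * B / b) + A * (1 + b + 2 * B / b) ^ 2)
      + 4 * B * (b + B + a + A) / b) (l : ℤ) :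
    (if l = 0 then 1 else 0) + majorVertex n l *
      (b * supersol b B a A n M (l - 1) + B * supersol b B a A n M (l - 2)
        + a * supersol b B a A n M (l + 1) + A * supersol b B a A n M (l + 2))
      ≤ supersol b B a A n M l := by
  have hn' : (3 : ℝ) ≤ n := by exact_mod_cast hn
  have hSpos : 0 < b + B + a + A := by positivity
  rcases lt_or_ge l 0 with h | h
  · have hv := lt_abs_vertex (n := n) (Or.inl h)
    refine majorVertex_mul_le (by linarith) ?_ h.ne (by omega)
    have key : ∀ l' : ℤ, l' ≤ 1 → supersol b B a A n M l' ≤ 1 := fun l' hl' =>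
      supersol_le_one hb hB ha hA hn hS hM0 hMG hl'
    have h1 : b * supersol b B a A n M (l - 1) + B * supersol b B a A n M (l - 2)
        + a * supersol b B a A n M (l + 1) + A * supersol b B a A n M (l + 2)
        ≤ b * 1 + B * 1 + a * 1 + A * 1 := by
      gcongr <;> exact key _ (by omega)
    refine h1.trans ?_
    rw [supersol_neg h, div_mul_eq_mul_div, le_div_iff₀ (by linarith)]
    nlinarith
  obtain ⟨k, rfl⟩ := Int.eq_ofNat_of_zero_le h
  rcases Nat.eq_zero_or_pos k with rfl | hk
  · have h0 := supersol_nat (b := b) (B := B) (a := a) (A := A) (M := M) (n := n) (k := 0) (by omega)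
    rw [h0, absSum_zero, greenSum]
    simp [majorVertex]
  rcases lt_trichotomy k n with hkn | rfl | hkn
  · have h2 : (1 : ℝ) ≤ k := by exact_mod_cast hk
    have h3 : (k : ℝ) + 1 ≤ n := by exact_mod_cast hkn
    have hv := vertex_pos hk hkn
    refine majorVertex_mul_le ?_ ?_ (by omega) (by omega)
    · refine lt_of_lt_of_le ?_ (le_abs_self _)
      rw [Int.cast_natCast]
      nlinarith
    · rw [Int.cast_natCast, abs_of_pos hv, supersol_nat hkn]
      have h4 := supersol_prev_le hb hB ha hA hn hM0 hk hkn
      have h5 := supersol_next_le hb hB hn hS hM0 hMG hk hkn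
      have h6 := amplification_bounds hM0 hMG hkn
      have hu := absSum_pos hb hB hkn
      have h7 := mul_le_mul_of_nonneg_left h5.1 ha
      have h8 := mul_le_mul_of_nonneg_left h5.2 hA
      have h9 : (1 + M * greenSum n k) * absSum b B n k ≤ 2 * absSum b B n k := by nlinarith
      have h10 : M * absSum b B n k = 2 * absSum b B n k
          + a * (2 * (1 + b + 2 * B / b) * absSum b B n k)
          + A * (2 * (1 + b + 2 * B / b) ^ 2 * absSum b B n k)
          + 4 * B * (b + B + a + A) / b * absSum b B n k := by
        conv_lhs => rw [hM]
        ring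
      linarith
  · rw [supersol_self, if_neg (by omega), majorVertex, if_pos (Or.inr rfl)]
    simp
  · have hkn' : (n : ℤ) < k := by exact_mod_cast hkn
    have hv := lt_abs_vertex (n := n) (Or.inr hkn')
    refine majorVertex_mul_le (by linarith) ?_ (by omega) (by omega)
    have key : ∀ l' : ℤ, (n : ℤ) - 1 ≤ l' →
        supersol b B a A n M l' ≤ 2 * absSum b B n (n - 1) := fun l' hl' =>
      supersol_le_of_ge hb hB hn hS hM0 hMG hl'
    have hu := absSum_pos hb hB (k := n - 1) (n := n) (by omega)
    set u := absSum b B n (n - 1) with hu'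
    have h1 : b * supersol b B a A n M (k - 1) + B * supersol b B a A n M (k - 2)
        + a * supersol b B a A n M (k + 1) + A * supersol b B a A n M (k + 2)
        ≤ b * (2 * u) + B * (2 * u) + a * (2 * u) + A * (2 * u) := by
      gcongr <;> exact key _ (by omega)
    refine h1.trans ?_
    rw [supersol_gt hkn', ← hu', div_mul_eq_mul_div, le_div_iff₀ (by linarith)]
    have : 0 < (b + B + a + A) * u := by positivity
    nlinarith

include hb hB ha hA hn hM0 in
-- The values beyond `n` carry a factor `1 / n`, which `log n ≥ 1` absorbs into `log n / n`.
theorem supersol_last_le :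
    b * supersol b B a A n M (n - 1) + B * supersol b B a A n M (n - 2)
        + a * supersol b B a A n M (n + 1) + A * supersol b B a A n M (n + 2)
      ≤ (b * absSum b B n (n - 1) + B * absSum b B n (n - 2))
        * (1 + (M + 2 * (b + B + a + A) * (a + A) / b) * (Real.log n / n)) := by
  have hn' : (3 : ℝ) ≤ n := by exact_mod_cast hn
  have hlog : (1 : ℝ) ≤ Real.log n := by
    rw [Real.le_log_iff_exp_le (by linarith)]
    exact Real.exp_one_lt_three.le.trans hn'
  have e1 : (n : ℤ) - 1 = ((n - 1 : ℕ) : ℤ) := by omega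
  have e2 : (n : ℤ) - 2 = ((n - 2 : ℕ) : ℤ) := by omega
  have h1 := absSum_pos hb hB (k := n - 1) (n := n) (by omega)
  have h2 := absSum_pos hb hB (k := n - 2) (n := n) (by omega)
  rw [e1, e2, supersol_nat (by omega), supersol_nat (by omega),
    supersol_gt (l := (n : ℤ) + 1) (by omega), supersol_gt (l := (n : ℤ) + 2) (by omega)]
  have hG := greenSum_le_log hn
  set u := absSum b B n (n - 1)
  set u' := absSum b B n (n - 2)
  set t := Real.log n / n
  have ht : 1 / (n : ℝ) ≤ t := by
    simp only [t]; gcongr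
  have g1 : M * greenSum n (n - 1) ≤ M * t := mul_le_mul_of_nonneg_left hG hM0
  have g2 : M * greenSum n (n - 2) ≤ M * t :=
    (mul_le_mul_of_nonneg_left (greenSum_le_last (by omega)) hM0).trans g1
  have k1 : b * ((1 + M * greenSum n (n - 1)) * u) ≤ b * ((1 + M * t) * u) := by gcongr
  have k2 : B * ((1 + M * greenSum n (n - 2)) * u') ≤ B * ((1 + M * t) * u') := by gcongr
  have k3 : a * (2 * (b + B + a + A) * u / n) + A * (2 * (b + B + a + A) * u / n)
      ≤ (b * u + B * u') * (2 * (b + B + a + A) * (a + A) / b * t) := by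
    have : a * (2 * (b + B + a + A) * u / n) + A * (2 * (b + B + a + A) * u / n)
      = (b * u) * (2 * (b + B + a + A) * (a + A) / b * (1 / n)) := by
      field_simp
    rw [this]
    have : 0 ≤ B * u' := by positivity
    gcongr
    linarith
  nlinarith

end MajorantBound

open Filter Topology in
/-- The sum of the absolute values over all paths exceeds the sum over the monotone paths by a
relative error of order `log n / n`. -/
theorem exists_majorant_bound {b B a A : ℝ} (hb : 0 < b) (hB : 0 ≤ B) (ha : 0 ≤ a) (hA : 0 ≤ A) :
    ∃ (C : ℝ) (N : ℕ), 0 ≤ C ∧ ∀ n : ℕ, N ≤ n → ∀ t : Finset (List ℤ),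
      ∑ x ∈ t, startWeight (stepWeight b B a A) (majorVertex n) n x
        ≤ (b * absSum b B n (n - 1) + B * absSum b B n (n - 2)) * (1 + C * (Real.log n / n)) := by
  set M := 2 + 2 * (a * (1 + b + 2 * B / b) + A * (1 + b + 2 * B / b) ^ 2)
      + 4 * B * (b + B + a + A) / b with hM
  have hM0 : 0 ≤ M := by positivity
  -- For large `n` this keeps the amplification `1 + M * greenSum n k` at most `2`.
  have hlim : Tendsto (fun n : ℕ => M * (Real.log n / n)) atTop (𝓝 (M * 0)) :=
    ((Real.isLittleO_log_id_atTop.tendsto_div_nhds_zero).comp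
      tendsto_natCast_atTop_atTop).const_mul M
  rw [mul_zero] at hlim
  obtain ⟨N₁, hN₁⟩ := eventually_atTop.1 (hlim.eventually_le_const zero_lt_one)
  obtain ⟨N₂, hN₂⟩ := exists_nat_ge (b + B + a + A)
  refine ⟨M + 2 * (b + B + a + A) * (a + A) / b, max 3 (max N₁ N₂), by positivity,
    fun n hn t => ?_⟩
  have hn3 : 3 ≤ n := (le_max_left _ _).trans hn
  have hnN₁ : N₁ ≤ n := (le_max_left _ _).trans ((le_max_right _ _).trans hn)
  have hnN₂ : N₂ ≤ n := (le_max_right _ _).trans ((le_max_right _ _).trans hn)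
  have hS : b + B + a + A ≤ n := hN₂.trans (by exact_mod_cast hnN₂)
  have hMG : M * greenSum n (n - 1) ≤ 1 :=
    (mul_le_mul_of_nonneg_left (greenSum_le_log hn3) hM0).trans (hN₁ n hnN₁)
  -- Through the cast to `ℂ`, nonnegativity of the majorant weights follows from
  -- `norm_startWeight_le`.
  have hst : ∀ m, ‖((stepWeight b B a A m : ℝ) : ℂ)‖ ≤ stepWeight b B a A m := by
    intro m
    rw [Complex.norm_real, Real.norm_of_nonneg]
    simp only [stepWeight]
    split_ifs <;> first | assumption | exact hb.le | exact le_rfl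
  have hvx : ∀ l, ‖((majorVertex n l : ℝ) : ℂ)‖ ≤ majorVertex n l := by
    intro l
    rw [Complex.norm_real, Real.norm_of_nonneg (majorVertex_nonneg (by omega) l)]
  refine (sum_startWeight_le hb.le hB ha hA (majorVertex_nonneg (by omega))
    (supersol_spec hb hB ha hA hn3 hS hM0 hMG hM)
    (supersol_nonneg hb hB ha hA hn3 hM0 hMG) n
    (fun x => (norm_nonneg _).trans (norm_startWeight_le hst hvx _ _)) t).trans ?_
  exact supersol_last_le hb hB ha hA hn3 hM0

/-! ### Closed form of the monotone sum via Kummer's equation -/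

section ClosedForm

open PowerSeries

theorem derivative_exp_mul_coeff (c : ℂ) :
    d⁄dX ℂ (PowerSeries.mk fun k => c ^ k / (k.factorial : ℂ))
      = C c * PowerSeries.mk fun k => c ^ k / (k.factorial : ℂ) := by
  ext k
  rw [coeff_derivative, coeff_C_mul, coeff_mk, coeff_mk, Nat.factorial_succ]
  have h1 : (k.factorial : ℂ) ≠ 0 := Nat.cast_ne_zero.2 k.factorial_ne_zero
  have h2 : (k : ℂ) + 1 ≠ 0 := Nat.cast_add_one_ne_zero k
  push_cast
  field_simp
  ring

/-- If `f = e^{βx/2} g`, then `4x²f'' + 4(1 - n)xf' - (2σβx + β²x²)f = e^{βx/2} q`. -/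
theorem whittaker_to_kummer (σ β N : ℂ) (E g : ℂ⟦X⟧) (hE : d⁄dX ℂ E = C (β / 2) * E) :
    4 * X ^ 2 * d⁄dX ℂ (d⁄dX ℂ (E * g)) + C (4 * (1 - N)) * X * d⁄dX ℂ (E * g)
        - (C (2 * σ * β) * X + C (β ^ 2) * X ^ 2) * (E * g)
      = E * (4 * X ^ 2 * d⁄dX ℂ (d⁄dX ℂ g) + C (4 * (1 - N)) * X * d⁄dX ℂ g
        + C (4 * β) * X ^ 2 * d⁄dX ℂ g + C (2 * β * (1 - N - σ)) * X * g) := by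
  have h1 : d⁄dX ℂ (E * g) = E * (d⁄dX ℂ g + C (β / 2) * g) := by
    rw [Derivation.leibniz, hE]; simp only [smul_eq_mul]; ring
  have h2 : d⁄dX ℂ (E * (d⁄dX ℂ g + C (β / 2) * g)) =
      E * (d⁄dX ℂ (d⁄dX ℂ g) + 2 * C (β / 2) * d⁄dX ℂ g + C (β / 2) ^ 2 * g) := by
    rw [Derivation.leibniz, hE, map_add, Derivation.leibniz, derivative_C]
    simp only [smul_eq_mul]; ring
  rw [h1, h2]
  have e1 : (C (β ^ 2) : ℂ⟦X⟧) = 4 * C (β / 2) ^ 2 := by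
    rw [← map_pow, show (4 : ℂ⟦X⟧) = C 4 from (map_ofNat C 4).symm, ← map_mul]; congr 1; ring
  have e2 : (C (4 * β) : ℂ⟦X⟧) = 8 * C (β / 2) := by
    rw [show (8 : ℂ⟦X⟧) = C 8 from (map_ofNat C 8).symm, ← map_mul]; congr 1; ring
  have e3 : (C (2 * β * (1 - N - σ)) : ℂ⟦X⟧) = C (4 * (1 - N)) * C (β / 2) - C (2 * σ * β) := by
    rw [← map_mul, ← map_sub]; congr 1; ring
  rw [e1, e2, e3]
  ring

theorem coeff_whittaker (p q r : ℂ) (f : ℂ⟦X⟧) (k : ℕ) :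
    coeff (k + 2) (4 * X ^ 2 * d⁄dX ℂ (d⁄dX ℂ f) + C p * X * d⁄dX ℂ f
        - (C q * X + C r * X ^ 2) * f)
      = (4 * (k + 1) * (k + 2) + p * (k + 2)) * coeff (k + 2) f - q * coeff (k + 1) f
        - r * coeff k f := by
  have e : 4 * X ^ 2 * d⁄dX ℂ (d⁄dX ℂ f) + C p * X * d⁄dX ℂ f - (C q * X + C r * X ^ 2) * f
      = C 4 * (X ^ 2 * d⁄dX ℂ (d⁄dX ℂ f)) + C p * (X * d⁄dX ℂ f) - C q * (X * f)
        - C r * (X ^ 2 * f) := by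
    rw [map_ofNat C 4]; ring
  rw [e]
  simp only [map_sub, map_add, coeff_C_mul, coeff_succ_X_mul, coeff_X_pow_mul, coeff_derivative]
  push_cast
  ring

theorem coeff_kummer (p s t : ℂ) (g : ℂ⟦X⟧) (k : ℕ) :
    coeff (k + 1) (4 * X ^ 2 * d⁄dX ℂ (d⁄dX ℂ g) + C p * X * d⁄dX ℂ g
        + C s * X ^ 2 * d⁄dX ℂ g + C t * X * g)
      = (4 * k * (k + 1) + p * (k + 1)) * coeff (k + 1) g + (s * k + t) * coeff k g := by
  have e : 4 * X ^ 2 * d⁄dX ℂ (d⁄dX ℂ g) + C p * X * d⁄dX ℂ g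
        + C s * X ^ 2 * d⁄dX ℂ g + C t * X * g
      = X * (C 4 * (X * d⁄dX ℂ (d⁄dX ℂ g)) + C p * d⁄dX ℂ g
        + C s * (X * d⁄dX ℂ g) + C t * g) := by
    rw [map_ofNat C 4]; ring
  rw [e, coeff_succ_X_mul]
  cases k with
  | zero =>
    have h : constantCoeff (d⁄dX ℂ g) = coeff 1 g := by
      rw [← coeff_zero_eq_constantCoeff_apply, coeff_derivative]; simp
    simp [h]
  | succ k =>
    simp only [map_add, coeff_C_mul, coeff_succ_X_mul, coeff_derivative]
    push_cast
    ring

/-- The Taylor coefficients of the Kummer function, cut off after the index `n - 1`. -/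
noncomputable def kummerCoeff (n : ℕ) (σ β : ℂ) : ℕ → ℂ
  | 0 => 1
  | k + 1 => if k + 1 < n then
      2 * β * (2 * k + 1 - n - σ) / (4 * (k + 1) * (n - (k + 1))) * kummerCoeff n σ β k else 0

theorem kummerCoeff_eq_prod (n : ℕ) (σ β : ℂ) (k : ℕ) (hk : k < n) :
    kummerCoeff n σ β k = β ^ k * (∏ i ∈ Finset.range k, 2 * (2 * (i : ℂ) + 1 - n - σ)) /
      ∏ i ∈ Finset.range k, 4 * ((i : ℂ) + 1) * (n - (i + 1)) := by
  induction k with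
  | zero => simp [kummerCoeff]
  | succ k ih =>
    rw [kummerCoeff, if_pos hk, ih (by omega), Finset.prod_range_succ, Finset.prod_range_succ,
      div_mul_div_comm]
    congr 1 <;> ring

theorem coeff_mul_of_forall_lt {R : Type*} [CommSemiring R] {E q : R⟦X⟧} {k : ℕ}
    (h : ∀ i < k, coeff i q = 0) : coeff k (E * q) = constantCoeff E * coeff k q := by
  rw [coeff_mul, Finset.sum_eq_single (0, k)]
  · simp
  · rintro ⟨i, j⟩ hij hne
    rw [Finset.HasAntidiagonal.mem_antidiagonal] at hij
    simp only at hij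
    have : j < k := by
      rcases Nat.eq_zero_or_pos i with rfl | hi
      · exact absurd (by simpa using hij) (by rintro rfl; exact hne rfl)
      · omega
    simp [h j this]
  · intro h; simp at h

/-- The truncated Kummer series solves its equation up to a defect `q` with no terms below `x^n`.
Below index `n` the monotone sums are therefore the coefficients of `E * g`, and the total is the
coefficient of `x^n` in `q`. -/
theorem monoSum_last (m : ℕ) (σ β : ℂ) (d : ℤ → ℂ)
    (hd : ∀ k : ℕ, 0 < k → k < m + 2 → d k = (4 * (k : ℂ) * ((m + 2 : ℕ) - k))⁻¹) :
    -2 * σ * β * monoSum (-2 * σ * β) (-β ^ 2) d (m + 1)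
        + -β ^ 2 * monoSum (-2 * σ * β) (-β ^ 2) d m
      = β ^ (m + 2) * (∏ i ∈ Finset.range (m + 2), 2 * (2 * (i : ℂ) + 1 - (m + 2 : ℕ) - σ)) /
        ∏ i ∈ Finset.range (m + 1), 4 * ((i : ℂ) + 1) * ((m + 2 : ℕ) - (i + 1)) := by
  set n := m + 2 with hn
  set E : ℂ⟦X⟧ := PowerSeries.mk fun k => (β / 2) ^ k / (k.factorial : ℂ)
  set g : ℂ⟦X⟧ := PowerSeries.mk (kummerCoeff n σ β)
  have hW := whittaker_to_kummer σ β n E g (derivative_exp_mul_coeff _)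
  set q := 4 * X ^ 2 * d⁄dX ℂ (d⁄dX ℂ g) + C (4 * (1 - (n : ℂ))) * X * d⁄dX ℂ g
        + C (4 * β) * X ^ 2 * d⁄dX ℂ g + C (2 * β * (1 - (n : ℂ) - σ)) * X * g with hq
  have hE0 : constantCoeff E = 1 := by simp [E]
  have hne : ∀ k : ℕ, 0 < k → k < n → (4 * (k : ℂ) * (n - k)) ≠ 0 := by
    intro k h0 h1
    have a1 : (k : ℂ) ≠ 0 := Nat.cast_ne_zero.2 (by omega)
    have a2 : (n : ℂ) - k ≠ 0 := sub_ne_zero.2 (Nat.cast_injective.ne (by omega))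
    exact mul_ne_zero (mul_ne_zero (by norm_num) a1) a2
  have hqk : ∀ k < n, coeff k q = 0 := by
    intro k hk
    cases k with
    | zero => simp [q]
    | succ k =>
      rw [hq, coeff_kummer]
      simp only [g, coeff_mk, kummerCoeff, if_pos hk]
      have := hne (k + 1) (by omega) hk
      push_cast at this
      linear_combination -kummerCoeff n σ β k *
        mul_div_cancel₀ (2 * β * (2 * (k : ℂ) + 1 - n - σ)) this
  have hqn : coeff n q = 2 * β * (2 * (m + 1 : ℕ) + 1 - n - σ) * kummerCoeff n σ β (m + 1) := by
    rw [hq, hn, coeff_kummer]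
    simp only [g, coeff_mk]
    rw [kummerCoeff, if_neg (by omega)]
    push_cast
    ring
  have hrec : ∀ k : ℕ, k + 2 ≤ n → 4 * ((k : ℂ) + 2) * (n - (k + 2)) * coeff (k + 2) (E * g)
      = -2 * σ * β * coeff (k + 1) (E * g) + -β ^ 2 * coeff k (E * g) - coeff (k + 2) q := by
    intro k hk
    have h := congrArg (coeff (k + 2)) hW
    rw [coeff_whittaker, coeff_mul_of_forall_lt fun i hi => hqk i (by omega), hE0] at h
    linear_combination -h
  have h0 : coeff 0 (E * g) = 1 := by
    rw [coeff_zero_eq_constantCoeff_apply, map_mul, hE0]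
    simp [g, kummerCoeff]
  have h1 : coeff 1 (E * g) = d 1 * (-2 * σ * β) := by
    have hd1 := hd 1 (by omega) (by omega)
    have := hne 1 (by omega) (by omega)
    push_cast at hd1 this
    rw [hd1, coeff_mul, Finset.Nat.antidiagonal_succ]
    simp [E, g, kummerCoeff, hn]
    simp [hn] at this
    field_simp
    ring
  have key : ∀ k < n, monoSum (-2 * σ * β) (-β ^ 2) d k = coeff k (E * g) := by
    intro k
    induction k using Nat.strong_induction_on with
    | _ k ih =>
      intro hk
      match k with
      | 0 => rw [h0, monoSum]
      | 1 => rw [h1, monoSum]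
      | k + 2 =>
        have hr := hrec k (by omega)
        rw [hqk _ hk, sub_zero] at hr
        have hd2 := hd (k + 2) (by omega) hk
        have := hne (k + 2) (by omega) hk
        push_cast at hd2 this
        rw [monoSum, ih (k + 1) (by omega) (by omega), ih k (by omega) (by omega), ← hr, hd2]
        rw [inv_mul_cancel_left₀ this]
  rw [key _ (by omega), key _ (by omega)]
  -- At this index the factor `n - (m + 2)` is zero, so the recurrence evaluates the total instead
  -- of defining a new coefficient.
  have hr := hrec m le_rfl
  rw [← hn, hqn] at hr
  have hz : ((n : ℂ) - (m + 2)) = 0 := by rw [hn]; push_cast; ring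
  rw [hz, mul_zero, zero_mul] at hr
  rw [sub_eq_zero.1 hr.symm, kummerCoeff_eq_prod _ _ _ _ (by omega), hn,
    Finset.prod_range_succ _ (m + 1)]
  push_cast
  ring

end ClosedForm

/-! ### Euler products for sine and cosine, with rate -/

section EulerProducts

open Filter Topology

/-- The partial products of `cos (πσ/2)` (even indices) and `(2/π) sin (πσ/2)` (odd indices). -/
noncomputable def eulerProd (σ : ℂ) : ℕ → ℂ
  | 0 => 1
  | 1 => σ
  | n + 2 => eulerProd σ n * (1 - σ ^ 2 / (n + 1) ^ 2)

theorem prod_mul_sub_eq_factorial (m : ℕ) :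
    ∏ i ∈ Finset.range m, 4 * ((i : ℂ) + 1) * ((m + 1 : ℕ) - (i + 1))
      = 4 ^ m * (m.factorial : ℂ) ^ 2 := by
  have h1 : ∏ i ∈ Finset.range m, ((i : ℂ) + 1) = m.factorial := by
    rw [← Finset.prod_range_add_one_eq_factorial]; push_cast; rfl
  have h2 : ∏ i ∈ Finset.range m, (((m + 1 : ℕ) : ℂ) - (i + 1)) = m.factorial := by
    rw [← h1, ← Finset.prod_range_reflect]
    refine Finset.prod_congr rfl fun i hi => ?_
    have := Finset.mem_range.1 hi
    rw [Nat.sub_sub, Nat.cast_sub (by omega)]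
    push_cast
    ring
  rw [Finset.prod_mul_distrib, Finset.prod_mul_distrib, h1, h2, Finset.prod_const,
    Finset.card_range]
  ring

/-- The first and last factors combine to `4(σ² - (n + 1)²)`; the inner ones are those for `n` after
an index shift. -/
theorem prod_shift_two (σ : ℂ) (n : ℕ) :
    ∏ i ∈ Finset.range (n + 2), 2 * (2 * (i : ℂ) + 1 - (n + 2 : ℕ) - σ)
      = 4 * (σ ^ 2 - (n + 1) ^ 2) * ∏ i ∈ Finset.range n, 2 * (2 * (i : ℂ) + 1 - n - σ) := by
  rw [Finset.prod_range_succ, Finset.prod_range_succ']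
  have : ∀ i ∈ Finset.range n, 2 * (2 * ((i + 1 : ℕ) : ℂ) + 1 - (n + 2 : ℕ) - σ)
      = 2 * (2 * (i : ℂ) + 1 - n - σ) := by
    intro i _; push_cast; ring
  rw [Finset.prod_congr rfl this]
  push_cast
  ring

/-- The factor `1` for even `n` and `i` for odd `n`. -/
noncomputable def parityFactor (n : ℕ) : ℂ := if Even n then 1 else Complex.I

theorem closed_form_eq_eulerProd (σ : ℂ) (m : ℕ) :
    (∏ i ∈ Finset.range (m + 2), 2 * (2 * (i : ℂ) + 1 - (m + 2 : ℕ) - σ)) /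
        (4 ^ (m + 1) * ((m + 1).factorial : ℂ) ^ 2)
      = 4 * parityFactor (m + 2) * (Complex.I / 2) ^ (m + 2) / (Nat.doubleFactorial m : ℂ) ^ 2
        * eulerProd σ (m + 2) := by
  induction m using Nat.twoStepInduction with
  | zero =>
    simp [Finset.prod_range_succ, parityFactor, eulerProd, div_pow]
    ring
  | one =>
    have h3 : ¬ Even 3 := by decide
    simp only [Finset.prod_range_succ, Finset.prod_range_zero, parityFactor, eulerProd, h3,
      if_false, div_pow, Nat.factorial]
    norm_num [Nat.factorial]
    linear_combination (1 / 2 * σ * (1 - σ ^ 2 / 4)) * Complex.I_sq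
  | more m ih _ =>
    have hp : parityFactor (m + 2 + 2) = parityFactor (m + 2) := by
      simp [parityFactor, Nat.even_add]
    have hfac : (((m + 2 + 1).factorial : ℕ) : ℂ) = (m + 3) * (m + 2) * ((m + 1).factorial : ℂ) := by
      rw [Nat.factorial_succ (m + 2), Nat.factorial_succ (m + 1)]; push_cast; ring
    have hdf : ((Nat.doubleFactorial (m + 2) : ℕ) : ℂ) = (m + 2) * (Nat.doubleFactorial m : ℂ) := by
      rw [Nat.doubleFactorial_add_two]; push_cast; ring
    have e1 : ((m : ℂ) + 2) ≠ 0 := by exact_mod_cast (by omega : m + 2 ≠ 0)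
    have e2 : ((m : ℂ) + 3) ≠ 0 := by exact_mod_cast (by omega : m + 3 ≠ 0)
    have hE : eulerProd σ (m + 2 + 2) = eulerProd σ (m + 2) * (1 - σ ^ 2 / (m + 3) ^ 2) := by
      rw [eulerProd]; push_cast; ring
    have hI : (Complex.I / 2) ^ (m + 2 + 2) = (Complex.I / 2) ^ (m + 2) * (-1 / 4) := by
      rw [pow_add _ (m + 2) 2, div_pow _ _ 2, Complex.I_sq]; norm_num
    calc _ = (∏ i ∈ Finset.range (m + 2), 2 * (2 * (i : ℂ) + 1 - (m + 2 : ℕ) - σ)) /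
        (4 ^ (m + 1) * ((m + 1).factorial : ℂ) ^ 2) *
          ((σ ^ 2 - (m + 3) ^ 2) / (4 * (m + 2) ^ 2 * (m + 3) ^ 2)) := by
          rw [prod_shift_two, hfac, div_mul_div_comm,
            show (4 : ℂ) ^ (m + 2 + 1) = 16 * 4 ^ (m + 1) by ring]
          push_cast
          rw [show ((m : ℂ) + 2 + 1) = m + 3 by ring]
          symm
          rw [← mul_div_mul_left _ _ (show (4 : ℂ) ≠ 0 by norm_num)]
          congr 1 <;> ring
      _ = _ := by
          rw [ih, hp, hdf, hE, hI]
          have : (σ ^ 2 - (m + 3) ^ 2) / (4 * (m + 2) ^ 2 * (m + 3) ^ 2)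
              = (-1 / 4) * (1 - σ ^ 2 / ((m : ℂ) + 3) ^ 2) / (m + 2) ^ 2 := by
            field_simp; ring
          rw [this]
          generalize (m : ℂ) + 2 = t
          ring

/-- Convergence bounds `p`, so its increments are `O(1 / (k + 1)²)`; comparing with `1 / k - 1 / (k
+ 1)` telescopes them to a tail of order `1 / k`. -/
theorem norm_sub_le_of_prod_rec {p w : ℕ → ℂ} {P : ℂ} {K : ℝ} (hK : 0 ≤ K)
    (hp : ∀ k, p (k + 1) = p k * (1 - w k)) (hw : ∀ k : ℕ, ‖w k‖ ≤ K / ((k : ℝ) + 1) ^ 2)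
    (hlim : Tendsto p atTop (𝓝 P)) :
    ∃ C : ℝ, 0 ≤ C ∧ (∀ k, ‖p k‖ ≤ C) ∧ ∀ k : ℕ, 1 ≤ k → ‖p k - P‖ ≤ C / k := by
  obtain ⟨S, hS⟩ := isBounded_iff_forall_norm_le.1 (Metric.isBounded_range_of_tendsto p hlim)
  have hS' : ∀ k, ‖p k‖ ≤ S := fun k => hS _ ⟨k, rfl⟩
  have hS0 : 0 ≤ S := (norm_nonneg _).trans (hS' 0)
  have step : ∀ k : ℕ, 1 ≤ k → ∀ j : ℕ,
      ‖p (k + j) - p k‖ ≤ S * K * (1 / (k : ℝ) - 1 / ((k : ℝ) + j)) := by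
    intro k hk j
    have hk' : (1 : ℝ) ≤ k := by exact_mod_cast hk
    induction j with
    | zero => simp
    | succ j ih =>
      have hj : (0 : ℝ) ≤ j := Nat.cast_nonneg j
      have h1 : ‖p (k + j + 1) - p (k + j)‖ ≤ S * (K / ((k : ℝ) + j + 1) ^ 2) := by
        rw [hp, show p (k + j) * (1 - w (k + j)) - p (k + j) = -(p (k + j) * w (k + j)) by ring,
          norm_neg, norm_mul]
        have := hw (k + j)
        push_cast at this
        exact mul_le_mul (hS' _) this (norm_nonneg _) hS0
      have h2 : 1 / ((k : ℝ) + j + 1) ^ 2 ≤ 1 / ((k : ℝ) + j) - 1 / ((k : ℝ) + j + 1) := by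
        rw [div_sub_div _ _ (by positivity) (by positivity), div_le_div_iff₀ (by positivity)
          (by positivity)]
        nlinarith
      have h3 : S * (K / ((k : ℝ) + j + 1) ^ 2)
          ≤ S * K * (1 / ((k : ℝ) + j) - 1 / ((k : ℝ) + j + 1)) := by
        rw [show S * (K / ((k : ℝ) + j + 1) ^ 2) = S * K * (1 / ((k : ℝ) + j + 1) ^ 2) by ring]
        exact mul_le_mul_of_nonneg_left h2 (by positivity)
      have h4 : ‖p (k + j + 1) - p k‖ ≤ ‖p (k + j + 1) - p (k + j)‖ + ‖p (k + j) - p k‖ :=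
        norm_sub_le_norm_sub_add_norm_sub _ _ _
      rw [Nat.cast_succ, ← add_assoc, ← add_assoc]
      linarith
  refine ⟨S + S * K, by positivity, fun k => (hS' k).trans (by nlinarith), fun k hk => ?_⟩
  have hk' : (0 : ℝ) < k := by exact_mod_cast hk
  have ht : Tendsto (fun j => ‖p (k + j) - p k‖) atTop (𝓝 ‖P - p k‖) := by
    refine (Tendsto.sub_const ?_ _).norm
    have := hlim.comp (tendsto_add_atTop_nat k)
    exact this.congr fun j => by simp [add_comm]
  rw [norm_sub_rev]
  refine le_of_tendsto ht (Eventually.of_forall fun j => (step k hk j).trans ?_)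
  have : S * K * (1 / (k : ℝ) - 1 / ((k : ℝ) + j)) ≤ S * K * (1 / (k : ℝ)) := by
    refine mul_le_mul_of_nonneg_left ?_ (by positivity)
    have : 0 ≤ 1 / ((k : ℝ) + j) := by positivity
    linarith
  refine this.trans ?_
  rw [mul_one_div]
  gcongr
  linarith

theorem sin_half_pi_ne_zero {σ : ℂ} (hσ : ∀ k : ℤ, σ ≠ (k : ℂ)) :
    Complex.sin (Real.pi * σ / 2) ≠ 0 := by
  intro h
  obtain ⟨k, hk⟩ := Complex.sin_eq_zero_iff.1 h
  have hpi : (Real.pi : ℂ) ≠ 0 := by exact_mod_cast Real.pi_ne_zero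
  refine hσ (2 * k) (mul_left_cancel₀ hpi ?_)
  push_cast
  linear_combination 2 * hk

theorem cos_half_pi_ne_zero {σ : ℂ} (hσ : ∀ k : ℤ, σ ≠ (k : ℂ)) :
    Complex.cos (Real.pi * σ / 2) ≠ 0 := by
  intro h
  obtain ⟨k, hk⟩ := Complex.cos_eq_zero_iff.1 h
  have hpi : (Real.pi : ℂ) ≠ 0 := by exact_mod_cast Real.pi_ne_zero
  refine hσ (2 * k + 1) (mul_left_cancel₀ hpi ?_)
  push_cast
  linear_combination 2 * hk

theorem eulerProd_odd_eq (σ : ℂ) (m : ℕ) :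
    eulerProd σ (2 * m + 1) = σ * ∏ j ∈ Finset.range m, (1 - (σ / 2) ^ 2 / ((j : ℂ) + 1) ^ 2) := by
  induction m with
  | zero => simp [eulerProd]
  | succ m ih =>
    rw [show 2 * (m + 1) + 1 = 2 * m + 1 + 2 by ring, eulerProd, ih, Finset.prod_range_succ]
    push_cast
    rw [show (2 * (m : ℂ) + 1 + 1) = 2 * (m + 1) by ring, mul_pow, div_pow, div_div, mul_assoc]

theorem eulerProd_mul_succ (σ : ℂ) (m : ℕ) :
    eulerProd σ m * eulerProd σ (m + 1)
      = σ * ∏ j ∈ Finset.range m, (1 - σ ^ 2 / ((j : ℂ) + 1) ^ 2) := by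
  induction m with
  | zero => simp [eulerProd]
  | succ m ih =>
    rw [Finset.prod_range_succ, ← mul_assoc, ← ih, eulerProd]
    ring

theorem tendsto_eulerProd_odd (σ : ℂ) :
    Tendsto (fun m => eulerProd σ (2 * m + 1)) atTop
      (𝓝 (2 / Real.pi * Complex.sin (Real.pi * σ / 2))) := by
  have hpi : (Real.pi : ℂ) ≠ 0 := by exact_mod_cast Real.pi_ne_zero
  have h := (Complex.tendsto_euler_sin_prod (σ / 2)).const_mul (2 / (Real.pi : ℂ))
  rw [← mul_div_assoc] at h
  refine h.congr fun m => ?_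
  rw [eulerProd_odd_eq]
  field_simp

/-- Consecutive partial products multiply to Euler's product for `sin (πσ) / π`. Dividing by the odd
limit, nonzero for nonintegral `σ`, and using the double angle formula gives the cosine. -/
theorem tendsto_eulerProd_even {σ : ℂ} (hσ : ∀ k : ℤ, σ ≠ (k : ℂ)) :
    Tendsto (fun m => eulerProd σ (2 * m)) atTop (𝓝 (Complex.cos (Real.pi * σ / 2))) := by
  have hpi : (Real.pi : ℂ) ≠ 0 := by exact_mod_cast Real.pi_ne_zero
  have hs := sin_half_pi_ne_zero hσ
  have h1 := ((Complex.tendsto_euler_sin_prod σ).comp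
    (tendsto_id.const_mul_atTop' (zero_lt_two' ℕ))).const_mul (1 / (Real.pi : ℂ))
  have h0 : (2 / (Real.pi : ℂ) * Complex.sin (Real.pi * σ / 2)) ≠ 0 :=
    mul_ne_zero (div_ne_zero two_ne_zero hpi) hs
  have h2 := h1.div (tendsto_eulerProd_odd σ) h0
  have e : 1 / (Real.pi : ℂ) * Complex.sin (Real.pi * σ)
      / (2 / Real.pi * Complex.sin (Real.pi * σ / 2)) = Complex.cos (Real.pi * σ / 2) := by
    rw [show (Real.pi : ℂ) * σ = 2 * (Real.pi * σ / 2) by ring, Complex.sin_two_mul,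
      show 2 * ((Real.pi : ℂ) * σ / 2) / 2 = Real.pi * σ / 2 by ring]
    field_simp
  rw [e] at h2
  refine h2.congr' ?_
  filter_upwards [(tendsto_eulerProd_odd σ).eventually_ne h0] with m hm
  have h3 := eulerProd_mul_succ σ (2 * m)
  simp only [Function.comp, Pi.div_apply, id]
  rw [div_eq_iff hm, h3]
  field_simp

/-- The limit of `eulerProd σ n` along the parity class of `n`. -/
noncomputable def eulerLimit (σ : ℂ) (n : ℕ) : ℂ :=
  if Even n then Complex.cos (Real.pi * σ / 2) else 2 / Real.pi * Complex.sin (Real.pi * σ / 2)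

theorem eulerProd_sub_eulerLimit {σ : ℂ} (hσ : ∀ k : ℤ, σ ≠ (k : ℂ)) :
    ∃ C : ℝ, 0 ≤ C ∧ (∀ n, ‖eulerProd σ n‖ ≤ C) ∧
      ∀ n : ℕ, 2 ≤ n → ‖eulerProd σ n - eulerLimit σ n‖ ≤ C / n := by
  have hK : 0 ≤ ‖σ‖ ^ 2 := by positivity
  obtain ⟨C₁, h₁, hb₁, hC₁⟩ := norm_sub_le_of_prod_rec (p := fun k => eulerProd σ (2 * k))
    (w := fun k => σ ^ 2 / ((2 * k : ℕ) + 1) ^ 2) hK (fun k => by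
      rw [show 2 * (k + 1) = 2 * k + 2 by ring, eulerProd]) (fun k => by
      rw [norm_div, norm_pow, norm_pow]
      have : ‖((2 * k : ℕ) : ℂ) + 1‖ = 2 * k + 1 := by
        rw [← Nat.cast_succ, Complex.norm_natCast]; push_cast; ring
      rw [this]
      gcongr
      linarith [(Nat.cast_nonneg k : (0 : ℝ) ≤ k)]) (tendsto_eulerProd_even hσ)
  obtain ⟨C₂, h₂, hb₂, hC₂⟩ := norm_sub_le_of_prod_rec (p := fun k => eulerProd σ (2 * k + 1))
    (w := fun k => σ ^ 2 / ((2 * k + 1 : ℕ) + 1) ^ 2) hK (fun k => by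
      rw [show 2 * (k + 1) + 1 = 2 * k + 1 + 2 by ring, eulerProd]) (fun k => by
      rw [norm_div, norm_pow, norm_pow]
      have : ‖((2 * k + 1 : ℕ) : ℂ) + 1‖ = 2 * k + 1 + 1 := by
        rw [← Nat.cast_succ, Complex.norm_natCast]; push_cast; ring
      rw [this]
      gcongr
      linarith [(Nat.cast_nonneg k : (0 : ℝ) ≤ k)]) (tendsto_eulerProd_odd σ)
  -- The factor `3` turns `1 / k` into `1 / n`: `n ≤ 3k` for `n = 2k` or `n = 2k + 1`, `k ≥ 1`.
  refine ⟨3 * (C₁ + C₂), by positivity, fun n => ?_, fun n hn => ?_⟩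
  · rcases Nat.even_or_odd' n with ⟨k, rfl | rfl⟩
    · exact (hb₁ k).trans (by linarith)
    · exact (hb₂ k).trans (by linarith)
  · rcases Nat.even_or_odd' n with ⟨k, rfl | rfl⟩
    · have hk : 1 ≤ k := by omega
      have hk' : (0 : ℝ) < k := by exact_mod_cast hk
      rw [eulerLimit, if_pos (by simp)]
      refine (hC₁ k hk).trans ?_
      push_cast
      rw [div_le_div_iff₀ hk' (by positivity)]
      nlinarith
    · have hk : 1 ≤ k := by omega
      have hk' : (1 : ℝ) ≤ k := by exact_mod_cast hk
      rw [eulerLimit, if_neg (by simp)]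
      refine (hC₂ k hk).trans ?_
      push_cast
      rw [div_le_div_iff₀ (by positivity) (by positivity)]
      nlinarith

theorem eulerLimit_ne_zero {σ : ℂ} (hσ : ∀ k : ℤ, σ ≠ (k : ℂ)) (n : ℕ) : eulerLimit σ n ≠ 0 := by
  have hpi : (Real.pi : ℂ) ≠ 0 := by exact_mod_cast Real.pi_ne_zero
  rw [eulerLimit]
  split_ifs
  · exact cos_half_pi_ne_zero hσ
  · exact mul_ne_zero (div_ne_zero two_ne_zero hpi) (sin_half_pi_ne_zero hσ)

end EulerProducts

/-! ### From walks to paths; reflection -/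

section Walks

theorem integral_exp_two_mul (k : ℤ) :
    ∫ x in (0 : ℝ)..Real.pi, Complex.exp (2 * Complex.I * k * x)
      = if k = 0 then (Real.pi : ℂ) else 0 := by
  split_ifs with hk
  · simp [hk]
  · have hc : 2 * Complex.I * (k : ℂ) ≠ 0 :=
      mul_ne_zero (mul_ne_zero two_ne_zero Complex.I_ne_zero) (Int.cast_ne_zero.2 hk)
    rw [integral_exp_mul_complex hc]
    have h : Complex.exp (2 * Complex.I * k * (Real.pi : ℂ)) = 1 := by
      rw [show 2 * Complex.I * k * (Real.pi : ℂ) = k * (2 * Real.pi * Complex.I) by ring]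
      exact Complex.exp_int_mul_two_pi_mul_I k
    rw [h]
    simp

theorem fourierCoeffPi_hillPotential (a b A B : ℂ) {m : ℤ} (hm : Even m) :
    fourierCoeffPi (hillPotential a b A B) m = stepWeight b B a A m := by
  obtain ⟨k, rfl⟩ := hm
  have hpi : (Real.pi : ℂ) ≠ 0 := by exact_mod_cast Real.pi_ne_zero
  have hint : ∀ (c : ℂ) (j : ℤ), IntervalIntegrable
      (fun x : ℝ => c * Complex.exp (2 * Complex.I * j * x)) MeasureTheory.volume 0 Real.pi :=
    fun c j => Continuous.intervalIntegrable (by fun_prop) _ _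
  have e : ∀ x : ℝ, hillPotential a b A B x * Complex.exp (-(Complex.I * ((k + k : ℤ) : ℂ) * x))
      = a * Complex.exp (2 * Complex.I * ((-1 - k : ℤ) : ℂ) * x)
        + b * Complex.exp (2 * Complex.I * ((1 - k : ℤ) : ℂ) * x)
        + A * Complex.exp (2 * Complex.I * ((-2 - k : ℤ) : ℂ) * x)
        + B * Complex.exp (2 * Complex.I * ((2 - k : ℤ) : ℂ) * x) := by
    intro x
    simp only [hillPotential, add_mul, mul_assoc, ← Complex.exp_add]
    congr 1
    · congr 1
      · congr 1
        · congr 2; push_cast; ring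
        · congr 2; push_cast; ring
      · congr 2; push_cast; ring
    · congr 2; push_cast; ring
  simp only [fourierCoeffPi, e]
  rw [intervalIntegral.integral_add (((hint _ _).add (hint _ _)).add (hint _ _)) (hint _ _),
    intervalIntegral.integral_add ((hint _ _).add (hint _ _)) (hint _ _),
    intervalIntegral.integral_add (hint _ _) (hint _ _)]
  simp only [intervalIntegral.integral_const_mul, integral_exp_two_mul, stepWeight]
  by_cases h1 : k = 1
  · subst h1; norm_num; field_simp
  by_cases h2 : k = 2
  · subst h2; norm_num; field_simp
  by_cases h3 : k = -1
  · subst h3; norm_num; field_simp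
  by_cases h4 : k = -2
  · subst h4; norm_num; field_simp
  rw [if_neg (by omega), if_neg (by omega), if_neg (by omega), if_neg (by omega), if_neg (by omega),
    if_neg (by omega), if_neg (by omega), if_neg (by omega)]
  simp

/-- The vertex weights `1 / (n² - j² + z)` in the coordinate `j = n - 2l`. -/
noncomputable def shiftedVertex (n : ℕ) (z : ℂ) (l : ℤ) : ℂ :=
  if l = 0 ∨ l = n then 0 else (4 * (l : ℂ) * (n - l) + z)⁻¹

theorem walkVertex_cons_succ (s m : ℤ) (x : List ℤ) (t : ℕ) :
    walkVertex s (m :: x) (t + 1) = walkVertex (s + m) x t := by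
  simp [walkVertex, add_assoc]

/-- `shiftedVertex` vanishes at `l = n` and `l = 0`, that is at `j = -n` and `j = n`. Paths visiting
these before their end thus get weight zero, which encodes admissibility; the end vertex itself is
not weighted. -/
theorem pathWeight_eq_ite {c V : ℤ → ℂ} (hc : ∀ m, ¬ Even m → c m = 0)
    (hV : ∀ m, Even m → V m = c m) (n : ℕ) (z : ℂ) (x : List ℤ) (l : ℤ) :
    pathWeight c (shiftedVertex n z) l x =
      open scoped Classical in
      if (∀ m ∈ x, Even m) ∧ x.sum = 2 * l ∧ (∀ t < x.length,
          walkVertex (n - 2 * l) x t ≠ -n ∧ walkVertex (n - 2 * l) x t ≠ n) then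
        (x.map V).prod * ∏ t ∈ Finset.range x.length,
          ((n : ℂ) ^ 2 - (walkVertex (n - 2 * l) x t : ℂ) ^ 2 + z)⁻¹
      else 0 := by
  induction x generalizing l with
  | nil =>
    by_cases h : l = 0 <;> simp [pathWeight, h, eq_comm]
  | cons m x ih =>
    rw [pathWeight]
    by_cases hm : Even m
    · obtain ⟨k, rfl⟩ := hm
      have hk : (k + k) / 2 = k := by omega
      rw [hk, ih]
      have hs : (n : ℤ) - 2 * l + (k + k) = n - 2 * (l - k) := by ring
      have hv0 : walkVertex (n - 2 * l) ((k + k) :: x) 0 = n - 2 * l := by simp [walkVertex]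
      by_cases hl : l = 0 ∨ l = n
      · rw [shiftedVertex, if_pos hl, zero_mul, zero_mul, if_neg]
        rintro ⟨-, -, h⟩
        have := h 0 (by simp)
        rw [hv0] at this
        omega
      · rw [shiftedVertex, if_neg hl]
        have hiff : ((∀ m ∈ (k + k) :: x, Even m) ∧ ((k + k) :: x).sum = 2 * l ∧
            (∀ t < ((k + k) :: x).length, walkVertex (n - 2 * l) ((k + k) :: x) t ≠ -n ∧
              walkVertex (n - 2 * l) ((k + k) :: x) t ≠ n)) ↔
            ((∀ m ∈ x, Even m) ∧ x.sum = 2 * (l - k) ∧ (∀ t < x.length,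
              walkVertex (n - 2 * (l - k)) x t ≠ -n ∧ walkVertex (n - 2 * (l - k)) x t ≠ n)) := by
          refine and_congr ?_ (and_congr ?_ ?_)
          · simp
          · rw [List.sum_cons]; constructor <;> intro h <;> linarith
          · constructor
            · intro h t ht
              have := h (t + 1) (by simpa using ht)
              rwa [walkVertex_cons_succ, hs] at this
            · intro h t ht
              cases t with
              | zero => rw [hv0]; omega
              | succ t =>
                rw [walkVertex_cons_succ, hs]
                exact h t (by simpa using ht)
        simp only [hiff]
        split_ifs with h
        · rw [List.length_cons, Finset.prod_range_succ', hv0, List.map_cons, List.prod_cons,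
            hV _ ⟨k, rfl⟩]
          simp only [walkVertex_cons_succ, hs]
          rw [show (n : ℂ) ^ 2 - ((n - 2 * l : ℤ) : ℂ) ^ 2 + z = 4 * (l : ℂ) * (n - l) + z by
            push_cast; ring]
          ring
        · rw [mul_zero]
    · rw [hc m hm, if_neg fun h => hm (h.1 m (by simp))]
      simp

theorem startWeight_eq_indicator {b B a A : ℂ} {V : ℤ → ℂ}
    (hV : ∀ m, Even m → V m = stepWeight b B a A m) {n : ℕ} (hn : 2 < n) (z : ℂ) :
    startWeight (stepWeight b B a A) (shiftedVertex n z) n =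
      (admissibleWalks (-(n : ℤ))).indicator fun x => walkWeight V (-(n : ℤ)) x z := by
  have hc : ∀ m : ℤ, ¬ Even m → stepWeight b B a A m = 0 := by
    intro m hm
    refine stepWeight_eq_zero _ _ _ _ fun h => hm ?_
    simp only [Finset.mem_insert, Finset.mem_singleton] at h
    rcases h with rfl | rfl | rfl | rfl <;> decide
  classical
  funext x
  rw [Set.indicator_apply]
  cases x with
  | nil => rw [startWeight, if_neg]; rintro ⟨h, -⟩; simp at h
  | cons m x =>
    rw [startWeight]
    by_cases hm : Even m
    · obtain ⟨k, rfl⟩ := hm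
      have hk : (k + k) / 2 = k := by omega
      rw [hk, pathWeight_eq_ite hc hV]
      have hs : -(n : ℤ) + (k + k) = n - 2 * (n - k) := by ring
      by_cases hx : x = []
      · subst hx
        rw [if_neg (c := _ ∈ admissibleWalks _) (by rintro ⟨h, -⟩; simp at h)]
        split_ifs with h
        · have h2 := h.2.1
          rw [List.sum_nil] at h2
          obtain rfl : k = n := by omega
          -- The single step `2n` is excluded by `ν ≥ 1`; it has weight zero anyway because `2n >
          -- 4`.
          rw [stepWeight, if_neg (by omega), if_neg, if_neg (by omega), if_neg (by omega),
            zero_mul]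
          omega
        · rw [mul_zero]
      · have hlen : 1 ≤ x.length := List.length_pos_iff.2 hx
        have hiff : (k + k) :: x ∈ admissibleWalks (-(n : ℤ)) ↔
            ((∀ m ∈ x, Even m) ∧ x.sum = 2 * (n - k) ∧ (∀ t < x.length,
              walkVertex (n - 2 * (n - k)) x t ≠ -n ∧ walkVertex (n - 2 * (n - k)) x t ≠ n)) := by
          constructor
          · rintro ⟨-, h1, h2, h3⟩
            refine ⟨fun m hm => h1 m (List.mem_cons_of_mem _ hm), ?_, fun t ht => ?_⟩
            · rw [List.sum_cons] at h2; linarith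
            · have := h3 (t + 1) (by omega) (by simpa using ht)
              rwa [walkVertex_cons_succ, hs, neg_neg] at this
          · rintro ⟨h1, h2, h3⟩
            refine ⟨by simpa using hlen, List.forall_mem_cons.2 ⟨⟨k, rfl⟩, h1⟩, ?_, ?_⟩
            · rw [List.sum_cons]; linarith
            · intro t ht1 ht
              obtain ⟨t, rfl⟩ := Nat.exists_eq_add_of_le' ht1
              rw [walkVertex_cons_succ, hs, neg_neg]
              exact h3 t (by simpa using ht)
        simp only [hiff]
        split_ifs with h
        · rw [walkWeight, List.length_cons, Finset.prod_Ico_eq_prod_range, Nat.add_sub_cancel,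
            List.map_cons, List.prod_cons, hV _ ⟨k, rfl⟩, Finset.prod_inv_distrib, ← mul_assoc,
            div_eq_mul_inv]
          congr 2
          refine Finset.prod_congr rfl fun t _ => ?_
          rw [add_comm 1 t, walkVertex_cons_succ, hs]
          push_cast
          ring
        · rw [mul_zero]
    · rw [hc m hm, zero_mul, if_neg]
      rintro ⟨-, h, -⟩
      exact hm (h m (by simp))

theorem sum_map_neg_int (x : List ℤ) : (x.map Neg.neg).sum = -x.sum := by
  induction x with
  | nil => simp
  | cons m x ih => rw [List.map_cons, List.sum_cons, List.sum_cons, ih]; ring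

theorem walkVertex_neg (s : ℤ) (x : List ℤ) (t : ℕ) :
    walkVertex (-s) (x.map Neg.neg) t = -walkVertex s x t := by
  rw [walkVertex, walkVertex, ← List.map_take, sum_map_neg_int]
  ring

theorem map_neg_map_neg (x : List ℤ) : (x.map Neg.neg).map Neg.neg = x := by
  simp

theorem map_neg_mem_admissibleWalks {s : ℤ} {x : List ℤ} (hx : x ∈ admissibleWalks s) :
    x.map Neg.neg ∈ admissibleWalks (-s) := by
  obtain ⟨h1, h2, h3, h4⟩ := hx
  refine ⟨by simpa using h1, ?_, ?_, fun t ht1 ht => ?_⟩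
  · intro m hm
    obtain ⟨m', hm', rfl⟩ := List.mem_map.1 hm
    exact (h2 m' hm').neg
  · rw [sum_map_neg_int, h3]; ring
  · have := h4 t ht1 (by simpa using ht)
    rw [walkVertex_neg]
    omega

/-- Reflection of walks. -/
def reflectWalks (s : ℤ) : admissibleWalks s ≃ admissibleWalks (-s) where
  toFun x := ⟨x.1.map Neg.neg, map_neg_mem_admissibleWalks x.2⟩
  invFun x := ⟨x.1.map Neg.neg, by simpa using map_neg_mem_admissibleWalks x.2⟩
  left_inv x := Subtype.ext (map_neg_map_neg _)
  right_inv x := Subtype.ext (map_neg_map_neg _)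

theorem walkWeight_reflect (V : ℤ → ℂ) (s : ℤ) (x : List ℤ) (z : ℂ) :
    walkWeight (fun m => V (-m)) (-s) (x.map Neg.neg) z = walkWeight V s x z := by
  rw [walkWeight, walkWeight, List.map_map, List.length_map]
  congr 1
  · congr 1
    refine List.map_congr_left fun m _ => ?_
    simp
  · refine Finset.prod_congr rfl fun t _ => ?_
    rw [walkVertex_neg]
    push_cast
    ring

end Walks

/-! ### Assembling the asymptotics -/

section Asymptotics

/-- The leading factor of the asymptotics. -/
noncomputable def leadingFactor (β : ℂ) (n : ℕ) : ℂ :=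
  4 * parityFactor n * (Complex.I * β / 2) ^ n / (Nat.doubleFactorial (n - 2) : ℂ) ^ 2

theorem norm_leadingFactor (β : ℂ) (n : ℕ) :
    ‖leadingFactor (Complex.I * ‖β‖) n‖ = ‖leadingFactor β n‖ := by
  simp [leadingFactor]

theorem leadingFactor_ne_zero {β : ℂ} (hβ : β ≠ 0) (n : ℕ) : leadingFactor β n ≠ 0 := by
  have h1 : parityFactor n ≠ 0 := by
    rw [parityFactor]; split_ifs
    · exact one_ne_zero
    · exact Complex.I_ne_zero
  have h2 : ((Nat.doubleFactorial (n - 2) : ℕ) : ℂ) ≠ 0 :=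
    Nat.cast_ne_zero.2 (Nat.doubleFactorial_pos _).ne'
  have h3 : Complex.I * β / 2 ≠ 0 :=
    div_ne_zero (mul_ne_zero Complex.I_ne_zero hβ) two_ne_zero
  exact div_ne_zero (mul_ne_zero (mul_ne_zero (by norm_num) h1) (pow_ne_zero _ h3))
    (pow_ne_zero _ h2)

theorem ofReal_monoSum (b B : ℝ) (d : ℤ → ℝ) (k : ℕ) :
    ((monoSum b B d k : ℝ) : ℂ) = monoSum (b : ℂ) (B : ℂ) (fun l => (d l : ℂ)) k := by
  induction k using Nat.twoStepInduction with
  | zero => simp [monoSum]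
  | one => simp [monoSum]
  | more k h0 h1 =>
    rw [monoSum, monoSum, ← h0, ← h1]
    push_cast
    ring

theorem monoSum_total {b B σ β : ℂ} (hb : b = -2 * σ * β) (hB : B = -β ^ 2) (m : ℕ) :
    b * monoSum b B (fun l => (monoVertex (m + 2) l : ℂ)) (m + 1)
        + B * monoSum b B (fun l => (monoVertex (m + 2) l : ℂ)) m
      = leadingFactor β (m + 2) * eulerProd σ (m + 2) := by
  have hd : ∀ k : ℕ, 0 < k → k < m + 2 →
      ((monoVertex (m + 2) k : ℝ) : ℂ) = (4 * (k : ℂ) * ((m + 2 : ℕ) - k))⁻¹ := by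
    intro k h0 h1
    rw [monoVertex, if_pos ⟨by exact_mod_cast h0, by exact_mod_cast h1⟩]
    push_cast
    rfl
  rw [hb, hB, monoSum_last m σ β _ hd]
  rw [prod_mul_sub_eq_factorial (m + 1), mul_div_assoc, closed_form_eq_eulerProd, leadingFactor,
    Nat.add_sub_cancel, show Complex.I * β / 2 = β * (Complex.I / 2) by ring, mul_pow β]
  ring

/-- Since `|b| = -2(i|σ|)(i|β|)` and `|B| = -(i|β|)²`, the closed form applies to the absolute
values too. Cancellation among monotone paths therefore costs only the Euler product at `i|σ|`. -/
theorem absSum_total {b B σ β : ℂ} (hb : b = -2 * σ * β) (hB : B = -β ^ 2) (m : ℕ) :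
    ‖b‖ * absSum ‖b‖ ‖B‖ (m + 2) (m + 1) + ‖B‖ * absSum ‖b‖ ‖B‖ (m + 2) m
      ≤ ‖leadingFactor β (m + 2)‖ * ‖eulerProd (Complex.I * ‖σ‖) (m + 2)‖ := by
  have hb' : ((‖b‖ : ℝ) : ℂ) = -2 * (Complex.I * ‖σ‖) * (Complex.I * ‖β‖) := by
    rw [hb, norm_mul, norm_mul, norm_neg, Complex.norm_ofNat]
    push_cast
    linear_combination (2 * (‖σ‖ : ℂ) * ‖β‖) * Complex.I_sq
  have hB' : ((‖B‖ : ℝ) : ℂ) = -(Complex.I * ‖β‖) ^ 2 := by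
    rw [hB, norm_neg, norm_pow, mul_pow, Complex.I_sq]
    push_cast
    ring
  have h := monoSum_total hb' hB' m
  rw [← norm_leadingFactor, ← norm_mul, ← h, ← ofReal_monoSum, ← ofReal_monoSum,
    ← Complex.ofReal_mul, ← Complex.ofReal_mul, ← Complex.ofReal_add, Complex.norm_real]
  exact le_abs_self _

/-- With `D = 4l(n - l)` and `0 < l < n`, the difference `1 / (D + z) - 1 / D` has modulus at most
`1 / ((D - 1) D) = 1 / (D - 1) - 1 / D`. Beyond that range `monoVertex` vanishes and `|D + z| ≥ |D|
- 1` is enough. -/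
theorem norm_shiftedVertex_sub_le {n : ℕ} (hn : 3 ≤ n) {z : ℂ} (hz : ‖z‖ ≤ 1) (l : ℤ) :
    ‖shiftedVertex n z l - (monoVertex n l : ℂ)‖ ≤ majorVertex n l - monoVertex n l := by
  have hn' : (3 : ℝ) ≤ n := by exact_mod_cast hn
  rw [shiftedVertex, majorVertex]
  split_ifs with h
  · rw [monoVertex, if_neg (by omega)]
    simp
  · set D : ℝ := 4 * (l : ℝ) * (n - l) with hD
    have hDc : 4 * (l : ℂ) * (n - l) = (D : ℂ) := by rw [hD]; push_cast; ring
    have hD1 : 1 < |D| := by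
      rcases lt_or_ge l 0 with h0 | h0
      · have := lt_abs_vertex (n := n) (Or.inl h0)
        rw [← hD] at this
        linarith
      rcases lt_or_ge (n : ℤ) l with h1 | h1
      · have := lt_abs_vertex (n := n) (Or.inr h1)
        rw [← hD] at this
        linarith
      · have h2 : (1 : ℝ) ≤ l := by exact_mod_cast (by omega : 1 ≤ l)
        have h3 : (l : ℝ) + 1 ≤ n := by exact_mod_cast (by omega : l + 1 ≤ n)
        refine lt_of_lt_of_le ?_ (le_abs_self _)
        rw [hD]
        nlinarith
    have hlow : |D| - 1 ≤ ‖(D : ℂ) + z‖ := by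
      have h1 : ‖(D : ℂ)‖ - ‖-z‖ ≤ ‖(D : ℂ) - -z‖ := norm_sub_norm_le _ _
      rw [sub_neg_eq_add, norm_neg, Complex.norm_real, Real.norm_eq_abs] at h1
      linarith
    have hpos : 0 < |D| - 1 := by linarith
    rw [hDc, monoVertex]
    split_ifs with h'
    · have h2 : (0 : ℝ) < l := by exact_mod_cast h'.1
      have h3 : (0 : ℝ) < n - l := by
        have : (l : ℝ) < n := by exact_mod_cast h'.2
        linarith
      have hDpos : 0 < D := by rw [hD]; positivity
      rw [← hD]
      rw [abs_of_pos hDpos] at hlow hpos ⊢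
      have hz0 : (D : ℂ) + z ≠ 0 := norm_pos_iff.1 (hpos.trans_le hlow)
      have hD0 : (D : ℂ) ≠ 0 := by exact_mod_cast hDpos.ne'
      have e : ((D : ℂ) + z)⁻¹ - ((D⁻¹ : ℝ) : ℂ) = -z / (((D : ℂ) + z) * D) := by
        push_cast; field_simp; ring
      have e' : (D - 1)⁻¹ - D⁻¹ = 1 / ((D - 1) * D) := by
        have := hpos.ne'
        field_simp; ring
      rw [e, e', norm_div, norm_neg, norm_mul, Complex.norm_real, Real.norm_of_nonneg hDpos.le]
      gcongr
    · rw [Complex.ofReal_zero, sub_zero, sub_zero, norm_inv]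
      exact inv_anti₀ hpos hlow

/-- The sum over all paths is the leading factor times a partial product, up to a relative error
of order `log n / n`. -/
theorem sum_startWeight_asymptotics {b B σ β : ℂ} (a A : ℂ) (hb0 : b ≠ 0) (hb : b = -2 * σ * β)
    (hB : B = -β ^ 2) :
    ∃ (C : ℝ) (N : ℕ), 0 ≤ C ∧ ∀ n : ℕ, N ≤ n → ∀ z : ℂ, ‖z‖ ≤ 1 →
      Summable (startWeight (stepWeight b B a A) (shiftedVertex n z) n) ∧
      ‖(∑' x, startWeight (stepWeight b B a A) (shiftedVertex n z) n x)
          - leadingFactor β n * eulerProd σ n‖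
        ≤ ‖leadingFactor β n‖ * ‖eulerProd (Complex.I * ‖σ‖) n‖ * (C * (Real.log n / n)) := by
  obtain ⟨C, N, hC, hbound⟩ := exists_majorant_bound (norm_pos_iff.2 hb0) (norm_nonneg B)
    (norm_nonneg a) (norm_nonneg A)
  refine ⟨C, max N 3, hC, fun n hn z hz => ?_⟩
  have hn3 : 3 ≤ n := (le_max_right _ _).trans hn
  have hG := hbound n ((le_max_left _ _).trans hn)
  obtain ⟨m, rfl⟩ := Nat.exists_eq_add_of_le' ((by norm_num : 2 ≤ 3).trans hn3)
  set n := m + 2 with hnm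
  set T := ‖b‖ * absSum ‖b‖ ‖B‖ n (n - 1) + ‖B‖ * absSum ‖b‖ ‖B‖ n (n - 2) with hT
  set F := startWeight (stepWeight b B a A) (shiftedVertex n z) n
  set F₀ := startWeight (stepWeight b B 0 0) (fun l => (monoVertex n l : ℂ)) n
  set G := startWeight (stepWeight ‖b‖ ‖B‖ ‖a‖ ‖A‖) (majorVertex n) n
  set G₀ := startWeight (stepWeight ‖b‖ ‖B‖ 0 0) (monoVertex n) n
  have hc₀ : ∀ k, ‖stepWeight b B 0 0 k‖ ≤ stepWeight ‖b‖ ‖B‖ 0 0 k := by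
    intro k; simp only [stepWeight]; split_ifs <;> simp
  have hc : ∀ k, ‖stepWeight b B a A k - stepWeight b B 0 0 k‖
      ≤ stepWeight ‖b‖ ‖B‖ ‖a‖ ‖A‖ k - stepWeight ‖b‖ ‖B‖ 0 0 k := by
    intro k; simp only [stepWeight]; split_ifs <;> simp
  have hd₀ : ∀ l, ‖((monoVertex n l : ℝ) : ℂ)‖ ≤ monoVertex n l := by
    intro l
    rw [Complex.norm_real, Real.norm_of_nonneg]
    rw [monoVertex]
    split_ifs with h
    · have h2 : (0 : ℝ) < l := by exact_mod_cast h.1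
      have h3 : (0 : ℝ) < n - l := by
        have : (l : ℝ) < n := by exact_mod_cast h.2
        linarith
      positivity
    · exact le_rfl
  -- Summed over all paths, the right side involves only the two totals of `G` and `G₀`.
  have hdiff : ∀ x, ‖F x - F₀ x‖ ≤ G x - G₀ x :=
    norm_startWeight_sub_le hc₀ hd₀ hc (norm_shiftedVertex_sub_le hn3 hz) n
  have hF₀G₀ : ∀ x, ‖F₀ x‖ ≤ G₀ x := norm_startWeight_le hc₀ hd₀ n
  have hGnn : ∀ x, 0 ≤ G x := fun x => by
    have h1 := (norm_nonneg _).trans (hdiff x)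
    have h2 := (norm_nonneg _).trans (hF₀G₀ x)
    linarith
  have hGs : Summable G := summable_of_sum_le hGnn hG
  have hGle : ∑' x, G x ≤ T * (1 + C * (Real.log n / n)) := hGs.tsum_le_of_sum_le hG
  have hv0 : monoVertex n 0 = 0 := by simp [monoVertex]
  have hG₀z : ∀ x ∉ stepLists (n + 1), G₀ x = 0 := fun x hx =>
    startWeight_mono_support _ _ _ hx
  have hF₀z : ∀ x ∉ stepLists (n + 1), F₀ x = 0 := fun x hx =>
    startWeight_mono_support _ _ _ hx
  have hG₀s : Summable G₀ := summable_of_ne_finset_zero hG₀z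
  have hF₀s : Summable F₀ := summable_of_ne_finset_zero hF₀z
  have hG₀t : ∑' x, G₀ x = T := by
    rw [tsum_eq_sum hG₀z]
    exact sum_startWeight_mono _ _ _ hv0 m
  have hF₀t : ∑' x, F₀ x = leadingFactor β n * eulerProd σ n := by
    rw [tsum_eq_sum hF₀z, ← monoSum_total hb hB m]
    exact sum_startWeight_mono _ _ _ (by simp [hv0]) m
  have hds : Summable fun x => F x - F₀ x :=
    Summable.of_norm_bounded (hGs.sub hG₀s) hdiff
  have hFs : Summable F := by simpa using hds.add hF₀s
  refine ⟨hFs, ?_⟩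
  have hTle : T ≤ ‖leadingFactor β n‖ * ‖eulerProd (Complex.I * ‖σ‖) n‖ := absSum_total hb hB m
  rw [← hF₀t, ← hFs.tsum_sub hF₀s]
  have h1 : ‖∑' x, (F x - F₀ x)‖ ≤ ∑' x, (G x - G₀ x) :=
    tsum_of_norm_bounded (hGs.sub hG₀s).hasSum hdiff
  rw [hGs.tsum_sub hG₀s, hG₀t] at h1
  have hlog : 0 ≤ Real.log n / n := by positivity
  have h2 : T * (C * (Real.log n / n))
      ≤ ‖leadingFactor β n‖ * ‖eulerProd (Complex.I * ‖σ‖) n‖ * (C * (Real.log n / n)) := by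
    gcongr
  linarith

theorem exists_relative_error {b B σ β : ℂ} (a A : ℂ) (hb0 : b ≠ 0) (hB0 : B ≠ 0)
    (hb : b = -2 * σ * β) (hB : B = -β ^ 2) (hσ : ∀ k : ℤ, σ ≠ (k : ℂ)) :
    ∃ (C : ℝ) (N : ℕ), ∀ n : ℕ, N ≤ n → ∀ z : ℂ, ‖z‖ ≤ 1 →
      Summable (startWeight (stepWeight b B a A) (shiftedVertex n z) n) ∧
      ∃ ε : ℂ, ‖ε‖ ≤ C * (Real.log n / n) ∧
        ∑' x, startWeight (stepWeight b B a A) (shiftedVertex n z) n x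
          = leadingFactor β n * eulerLimit σ n * (1 + ε) := by
  have hβ : β ≠ 0 := by rintro rfl; exact hB0 (by rw [hB]; simp)
  have hσ0 : σ ≠ 0 := by simpa using hσ 0
  -- A nonzero imaginary number is no integer, so the Euler products at `i|σ|` converge; only their
  -- boundedness is needed.
  have hσ' : ∀ k : ℤ, Complex.I * (‖σ‖ : ℂ) ≠ k := by
    intro k h
    have := congrArg Complex.im h
    simp at this
    exact hσ0 this
  obtain ⟨C₁, N, hC₁, h₁⟩ := sum_startWeight_asymptotics a A hb0 hb hB
  obtain ⟨K, hK, hKb, -⟩ := eulerProd_sub_eulerLimit hσ'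
  obtain ⟨C₂, hC₂, -, h₂⟩ := eulerProd_sub_eulerLimit hσ
  -- `eulerLimit` takes only two values, one per parity, so its inverse is bounded uniformly in `n`.
  set R := ‖eulerLimit σ 0‖⁻¹ + ‖eulerLimit σ 1‖⁻¹ with hR
  have hRn : ∀ n, ‖eulerLimit σ n‖⁻¹ ≤ R := by
    intro n
    have h0 : 0 ≤ ‖eulerLimit σ 0‖⁻¹ := by positivity
    have h1 : 0 ≤ ‖eulerLimit σ 1‖⁻¹ := by positivity
    rcases Nat.even_or_odd n with h | h
    · have : eulerLimit σ n = eulerLimit σ 0 := by simp [eulerLimit, h]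
      rw [this]; linarith
    · have : eulerLimit σ n = eulerLimit σ 1 := by
        simp [eulerLimit, Nat.not_even_iff_odd.2 h]
      rw [this]; linarith
  refine ⟨(K * C₁ + C₂) * R, max N 3, fun n hn z hz => ?_⟩
  have hn3 : 3 ≤ n := (le_max_right _ _).trans hn
  obtain ⟨hs, hle⟩ := h₁ n ((le_max_left _ _).trans hn) z hz
  refine ⟨hs, ?_⟩
  have hle₂ := h₂ n (by omega)
  have hP := leadingFactor_ne_zero hβ n
  have hL := eulerLimit_ne_zero hσ n
  set S := ∑' x, startWeight (stepWeight b B a A) (shiftedVertex n z) n x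
  set P := leadingFactor β n
  set L := eulerLimit σ n
  have hn' : (3 : ℝ) ≤ n := by exact_mod_cast hn3
  have hlog : (1 : ℝ) ≤ Real.log n := by
    rw [Real.le_log_iff_exp_le (by linarith)]
    exact Real.exp_one_lt_three.le.trans hn'
  set t := Real.log n / n with ht
  have ht0 : 0 ≤ t := by positivity
  refine ⟨(S - P * L) / (P * L), ?_, ?_⟩
  · have hnum : ‖S - P * L‖ ≤ ‖P‖ * ((K * C₁ + C₂) * t) := by
      have e : S - P * L = (S - P * eulerProd σ n) + P * (eulerProd σ n - L) := by ring
      have g1 : ‖P‖ * ‖eulerProd (Complex.I * ‖σ‖) n‖ * (C₁ * t) ≤ ‖P‖ * K * (C₁ * t) := by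
        gcongr
        exact hKb n
      have g2 : ‖P * (eulerProd σ n - L)‖ ≤ ‖P‖ * (C₂ * t) := by
        rw [norm_mul]
        refine mul_le_mul_of_nonneg_left (hle₂.trans ?_) (norm_nonneg _)
        rw [ht, ← mul_div_assoc]
        gcongr
        nlinarith
      calc ‖S - P * L‖ ≤ ‖S - P * eulerProd σ n‖ + ‖P * (eulerProd σ n - L)‖ := by
            rw [e]; exact norm_add_le _ _
        _ ≤ ‖P‖ * K * (C₁ * t) + ‖P‖ * (C₂ * t) := add_le_add (hle.trans g1) g2
        _ = ‖P‖ * ((K * C₁ + C₂) * t) := by ring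
    have hPpos : 0 < ‖P‖ := norm_pos_iff.2 hP
    rw [norm_div, norm_mul, div_eq_mul_inv, mul_inv]
    calc ‖S - P * L‖ * (‖P‖⁻¹ * ‖L‖⁻¹)
        ≤ (‖P‖ * ((K * C₁ + C₂) * t)) * (‖P‖⁻¹ * R) := by
          gcongr
          exact hRn n
      _ = (K * C₁ + C₂) * R * t := by
          field_simp
  · field_simp
    ring

theorem stepWeight_neg (b B a A : ℂ) (m : ℤ) :
    stepWeight b B a A (-m) = stepWeight a A b B m := by
  simp only [stepWeight]
  by_cases h1 : m = 2
  · subst h1; norm_num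
  by_cases h2 : m = 4
  · subst h2; norm_num
  by_cases h3 : m = -2
  · subst h3; norm_num
  by_cases h4 : m = -4
  · subst h4; norm_num
  rw [if_neg (by omega), if_neg (by omega), if_neg (by omega), if_neg (by omega), if_neg (by omega),
    if_neg (by omega), if_neg (by omega), if_neg (by omega)]

end Asymptotics

theorem mainTheorem5 (a b A B α β τ σ : ℂ)
    (ha : a ≠ 0) (hb : b ≠ 0) (hA : A ≠ 0) (hB : B ≠ 0)
    (hAα : A = -α ^ 2) (haτ : a = -2 * τ * α) (hBβ : B = -β ^ 2) (hbσ : b = -2 * σ * β)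
    (hτ : ∀ k : ℤ, τ ≠ (k : ℂ)) (hσ : ∀ k : ℤ, σ ≠ (k : ℂ)) :
    ∃ (C : ℝ) (N : ℕ), ∀ n : ℕ, N ≤ n → ∀ z : ℂ, ‖z‖ ≤ 1 →
      -- the series that define `B⁺(n, z)` and `B⁻(n, z)` converge (absolutely)
      Summable (fun x : admissibleWalks (-(n : ℤ)) =>
        walkWeight (fourierCoeffPi (hillPotential a b A B)) (-(n : ℤ)) x z) ∧
      Summable (fun x : admissibleWalks (n : ℤ) =>
        walkWeight (fourierCoeffPi (hillPotential a b A B)) (n : ℤ) x z) ∧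
      (Even n →
        (∃ ε : ℂ, ‖ε‖ ≤ C * (Real.log n / n) ∧
          walkSumPlus (hillPotential a b A B) n z =
            4 * (Complex.I * β / 2) ^ n / (Nat.doubleFactorial (n - 2) : ℂ) ^ 2
              * Complex.cos (Real.pi * σ / 2) * (1 + ε)) ∧
        (∃ ε : ℂ, ‖ε‖ ≤ C * (Real.log n / n) ∧
          walkSumMinus (hillPotential a b A B) n z =
            4 * (Complex.I * α / 2) ^ n / (Nat.doubleFactorial (n - 2) : ℂ) ^ 2
              * Complex.cos (Real.pi * τ / 2) * (1 + ε))) ∧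
      (Odd n →
        (∃ ε : ℂ, ‖ε‖ ≤ C * (Real.log n / n) ∧
          walkSumPlus (hillPotential a b A B) n z =
            4 * Complex.I * (Complex.I * β / 2) ^ n / (Nat.doubleFactorial (n - 2) : ℂ) ^ 2
              * (2 / Real.pi) * Complex.sin (Real.pi * σ / 2) * (1 + ε)) ∧
        (∃ ε : ℂ, ‖ε‖ ≤ C * (Real.log n / n) ∧
          walkSumMinus (hillPotential a b A B) n z =
            4 * Complex.I * (Complex.I * α / 2) ^ n / (Nat.doubleFactorial (n - 2) : ℂ) ^ 2
              * (2 / Real.pi) * Complex.sin (Real.pi * τ / 2) * (1 + ε))) := by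
  obtain ⟨C₁, N₁, h₁⟩ := exists_relative_error a A hb hB hbσ hBβ hσ
  obtain ⟨C₂, N₂, h₂⟩ := exists_relative_error b B ha hA haτ hAα hτ
  refine ⟨max C₁ C₂, max (max N₁ N₂) 3, fun n hn z hz => ?_⟩
  have hn3 : 2 < n := (le_max_right _ _).trans hn
  obtain ⟨hs₁, ε₁, hε₁, ht₁⟩ :=
    h₁ n ((le_max_left _ _).trans ((le_max_left _ _).trans hn)) z hz
  obtain ⟨hs₂, ε₂, hε₂, ht₂⟩ :=
    h₂ n ((le_max_right _ _).trans ((le_max_left _ _).trans hn)) z hz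
  have hlog : 0 ≤ Real.log n / n := by positivity
  set V := fourierCoeffPi (hillPotential a b A B) with hVdef
  have hV : ∀ m, Even m → V m = stepWeight b B a A m :=
    fun m hm => fourierCoeffPi_hillPotential a b A B hm
  -- Negating the steps swaps `(b, B)` with `(a, A)`, so `B⁻` is the sum over walks from `-n` to `n`
  -- with the roles of `(σ, β)` and `(τ, α)` exchanged.
  have hV' : ∀ m, Even m → (fun k => V (-k)) m = stepWeight a A b B m := fun m hm => by
    rw [← stepWeight_neg]; exact hV _ hm.neg
  rw [startWeight_eq_indicator hV hn3] at hs₁ ht₁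
  rw [startWeight_eq_indicator hV' hn3] at hs₂ ht₂
  rw [← tsum_subtype] at ht₁ ht₂
  have hs₁' := summable_subtype_iff_indicator.2 hs₁
  have hs₂' := summable_subtype_iff_indicator.2 hs₂
  have hrefl : ∀ x : admissibleWalks (n : ℤ),
      walkWeight (fun k => V (-k)) (-(n : ℤ)) (reflectWalks n x) z = walkWeight V n x z :=
    fun x => walkWeight_reflect V n x z
  have ht₂' : ∑' x : admissibleWalks (n : ℤ), walkWeight V n x z
      = leadingFactor α n * eulerLimit τ n * (1 + ε₂) := by
    rw [← ht₂, ← (reflectWalks n).tsum_eq]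
    exact tsum_congr fun x => (hrefl x).symm
  have hε₁' := hε₁.trans (mul_le_mul_of_nonneg_right (le_max_left C₁ C₂) hlog)
  have hε₂' := hε₂.trans (mul_le_mul_of_nonneg_right (le_max_right C₁ C₂) hlog)
  refine ⟨hs₁', ?_, fun he => ⟨⟨ε₁, hε₁', ?_⟩, ⟨ε₂, hε₂', ?_⟩⟩,
    fun ho => ⟨⟨ε₁, hε₁', ?_⟩, ⟨ε₂, hε₂', ?_⟩⟩⟩
  · exact ((reflectWalks n).summable_iff.2 hs₂').congr fun x => hrefl x
  · rw [walkSumPlus, ht₁, leadingFactor, parityFactor, eulerLimit, if_pos he, if_pos he, mul_one]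
  · rw [walkSumMinus, ht₂', leadingFactor, parityFactor, eulerLimit, if_pos he, if_pos he, mul_one]
  · rw [walkSumPlus, ht₁, leadingFactor, parityFactor, eulerLimit,
      if_neg (Nat.not_even_iff_odd.2 ho), if_neg (Nat.not_even_iff_odd.2 ho)]
    ring
  · rw [walkSumMinus, ht₂', leadingFactor, parityFactor, eulerLimit,
      if_neg (Nat.not_even_iff_odd.2 ho), if_neg (Nat.not_even_iff_odd.2 ho)]
    ring
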